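/- Setting. Let $L_n:\mathbb R^p\to(-\infty,+\infty]$ be a proper, closed, convex function whose domain $\mathbf{dom}\,L_n$ is open and contains $\mathbf 0$, whose second derivative exists at every point of the domain, and with $\nabla L_n(\mathbf 0)\neq\mathbf 0$. Assume that for some constants $\beta>0$, $0\le\gamma_1<2$, $0\le\gamma_2<2$, $$\|\nabla L_n(\theta+\delta)-\nabla L_n(\theta)-\nabla^2L_n(\theta)\delta\|_2\le\beta\,\delta^\top[\nabla^2L_n(\theta)]^{\gamma_1}\delta$$ whenever $\theta,\theta+\delta\in\mathbf{dom}\,L_n$ and $\delta^\top[\nabla^2L_n(\theta)]^{\gamma_2}\delta\le\beta^{-2}$ (with $[\,\cdot\,]^0=I$). For $t\in[0,\infty]$ put $f_t(\theta)=(1-e^{-t})L_n(\theta)+\frac{e^{-t}}2\|\theta\|_2^2$ on $\mathbf{dom}\,L_n$ (with $e^{-\infty}=0$), and let $\theta(t)$ be the minimizer of $f_t$ over $\mathbf{dom}\,L_n$; $\theta(\infty)$ is the minimum-norm minimizer of $L_n$. For finite $t_{\max}$ the condition $\|\theta(t_{\max})\|_2<\infty$ always holds, and for $t_{\max}=\infty$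 it means that $L_n$ has a minimizer. Newton method. Put $t_0=0$, $\theta_0=\mathbf 0$, $t_{k+1}=t_k+\alpha_{k+1}$ and $$\theta_{k+1}=\theta_k-\big((1-e^{-t_{k+1}})\nabla^2L_n(\theta_k)+e^{-t_{k+1}}I\big)^{-1}\big((1-e^{-t_{k+1}})\nabla L_n(\theta_k)+e^{-t_{k+1}}\theta_k\big).$$ Let $\nu$ be the largest eigenvalue of $\nabla^2L_n(\mathbf 0)$, $C_2=442$, and let $C_1=15$ if $\gamma_1\le1$ and $C_1=15\min\big(\nu^{\gamma_1-1},\nu^{\gamma_1}e^{-\alpha_1}(1-e^{-\alpha_1})\big)$ if $\gamma_1>1$. Given $\epsilon>0$ and $0<\alpha_{\max}\le 10^{-1}$, the step sizes are any $\alpha_1>0$ with $$\alpha_1\le\min\Big\{\alpha_{\max},\ \ln\Big(1+\tfrac{\sqrt\epsilon}{\|\nabla L_n(\mathbf 0)\|_2}\Big),\ \ln\Big(1+\big(\max(C_1,\sqrt2C_2)\,\beta\,\|\nabla L_n(\mathbf 0)\|_2\big)^{-1/\min(2-\gamma_1,\,1-\gamma_2/2)}\Big)\Big\}$$ and, for $k\ge1$,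 $$\alpha_{k+1}=\min\Big\{\alpha_{\max},\ 2\alpha_k,\ \ln\Big(1+\tfrac{e^{t_k/2}(e^{\alpha_1}-1)\|\nabla L_n(\mathbf 0)\|_2(1-e^{-t_k})}{\|\theta_k\|_2}\Big),\ \ln\Big(1+\big(C_2\beta e^{t_k}\max\big((e^{t_k}-1)^{-\gamma_1},(e^{t_k}-1)^{-1-\gamma_2/2}\big)\|\theta_k\|_2\big)^{-1}\Big)\Big\}.$$ The method terminates at the first $N\ge1$ for which $$t_N>t_{\max}\quad\text{or}\quad\frac{2\|\theta_N\|_2^2}{e^{t_N}-1}\le(e^{\alpha_1}-1)^2\|\nabla L_n(\mathbf 0)\|_2^2 .$$ The generated path $\tilde\theta(t)$ is the linear interpolation of $\theta_0,\dots,\theta_N$ at $t_0<\dots<t_N$, and $\tilde\theta(t)=\theta_N$ for $t>t_N$. Theorem. Suppose $t_{\max}\in(0,\infty]$ and $\|\theta(t_{\max})\|_2<\infty$. Then there is a constant $C>0$, depending only on $L_n$ and $t_{\max}$, such that for every choice of $\beta,\gamma_1,\gamma_2$ as above, every $\epsilon>0$, every $\alpha_{\max}\in(0,10^{-1}]$ and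 every admissible $\alpha_1$, the Newton method terminates after a finite number $N$ of iterations, the iterates $\theta_0,\dots,\theta_N$ and the path $\tilde\theta(t)$, $0\le t\le t_{\max}$, lie in $\mathbf{dom}\,L_n$, and $$\sup_{0\le t\le t_{\max}}\{f_t(\tilde\theta(t))-f_t(\theta(t))\}\le C\,\epsilon .$$ This includes the case $t_{\max}=\infty$. -/

import Mathlib

open scoped RealInnerProductSpace

noncomputable section

namespace NewtonPath

/-- The parameter space `ℝ^p` with its Euclidean norm. -/
abbrev Vec (p : ℕ) := EuclideanSpace ℝ (Fin p)

variable {p : ℕ}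

/-! ### The loss function

The extended-valued loss is given by its effective domain `S` and by its values `L` on `S`;
it is understood to be `+∞` outside `S`. -/

/-- The Hessian `∇² L (x)`, as a linear operator. -/
def hess (L : Vec p → ℝ) (x : Vec p) : Vec p →L[ℝ] Vec p :=
  fderiv ℝ (gradient L) x

/-- The power `T ^ γ` of a symmetric positive semidefinite operator, by functional calculus
(apply `s ↦ s ^ γ` to the eigenvalues; `0 ^ 0 = 1`, so that `T ^ 0` is the identity). -/
def opPow (T : Vec p →L[ℝ] Vec p) (γ : ℝ) : Vec p →L[ℝ] Vec p :=
  Matrix.toEuclideanCLM (n := Fin p) (𝕜 := ℝ)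
    (cfc (fun s : ℝ => s ^ γ) ((Matrix.toEuclideanCLM (n := Fin p) (𝕜 := ℝ)).symm T))

/-- `L` (with effective domain `S`) is a closed proper convex function whose second derivative
exists at every point of its (open) domain, and the domain contains the origin. -/
structure IsLoss (S : Set (Vec p)) (L : Vec p → ℝ) : Prop where
  isOpen_dom : IsOpen S
  zero_mem : (0 : Vec p) ∈ S
  convex : ConvexOn ℝ S L
  isClosed_epigraph : IsClosed {q : Vec p × ℝ | q.1 ∈ S ∧ L q.1 ≤ q.2}
  differentiable : ∀ x ∈ S, DifferentiableAt ℝ L x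
  differentiable_gradient : ∀ x ∈ S, DifferentiableAt ℝ (gradient L) x

/-- The local Lipschitz condition on the Hessian with constants `β, γ₁, γ₂`. -/
structure LocalLipschitzHessian (S : Set (Vec p)) (L : Vec p → ℝ) (β γ₁ γ₂ : ℝ) : Prop where
  beta_pos : 0 < β
  gamma₁_nonneg : 0 ≤ γ₁
  gamma₁_lt : γ₁ < 2
  gamma₂_nonneg : 0 ≤ γ₂
  gamma₂_lt : γ₂ < 2
  bound : ∀ x ∈ S, ∀ d : Vec p, x + d ∈ S → ⟪d, opPow (hess L x) γ₂ d⟫ ≤ (β ^ 2)⁻¹ →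
    ‖gradient L (x + d) - gradient L x - hess L x d‖ ≤ β * ⟪d, opPow (hess L x) γ₁ d⟫

/-! ### The regularized problem and its solution path -/

/-- `e^{-t}` for an extended real time `t`, with `e^{-∞} = 0`. -/
def expNeg (t : EReal) : ℝ := (EReal.exp (-t)).toReal

/-- `f_t(x) = (1 - e^{-t}) L(x) + (e^{-t} / 2) ‖x‖²`; in particular `f_∞ = L`. -/
def objective (L : Vec p → ℝ) (t : EReal) (x : Vec p) : ℝ :=
  (1 - expNeg t) * L x + expNeg t / 2 * ‖x‖ ^ 2

/-- `x` minimizes `f_t` over the domain. -/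
def IsMinimizer (S : Set (Vec p)) (L : Vec p → ℝ) (t : EReal) (x : Vec p) : Prop :=
  x ∈ S ∧ ∀ y ∈ S, objective L t x ≤ objective L t y

/-- `x` is the minimizer of `f_t` of minimum norm. (For `t < ∞` the minimizer is unique; for
`t = ∞` this is the minimum norm minimizer of `L`.) -/
def IsPathPoint (S : Set (Vec p)) (L : Vec p → ℝ) (t : EReal) (x : Vec p) : Prop :=
  IsMinimizer S L t x ∧ ∀ y, IsMinimizer S L t y → ‖x‖ ≤ ‖y‖

/-- The solution path `θ(t)`, `0 ≤ t ≤ ∞`. -/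
def solutionPath (S : Set (Vec p)) (L : Vec p → ℝ) (t : EReal) : Vec p :=
  Classical.epsilon (IsPathPoint S L t)

/-! ### The Newton path-following method -/

/-- One Newton step for `f_t` starting from `x`. -/
def newtonStep (L : Vec p → ℝ) (t : ℝ) (x : Vec p) : Vec p :=
  x - ((1 - Real.exp (-t)) • hess L x +
      Real.exp (-t) • ContinuousLinearMap.id ℝ (Vec p)).inverse
    ((1 - Real.exp (-t)) • gradient L x + Real.exp (-t) • x)

/-- The maximum eigenvalue of `∇² L (0)`. -/
def maxEigenvalue (L : Vec p → ℝ) : ℝ :=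
  sSup {μ : ℝ | Module.End.HasEigenvalue (hess L 0 : Vec p →ₗ[ℝ] Vec p) μ}

/-- The constant `C₁`. -/
def constC₁ (L : Vec p → ℝ) (γ₁ α₁ : ℝ) : ℝ :=
  if γ₁ ≤ 1 then 15
  else 15 * min (maxEigenvalue L ^ (γ₁ - 1))
    (maxEigenvalue L ^ γ₁ * Real.exp (-α₁) * (1 - Real.exp (-α₁)))

/-- The constant `C₂`. -/
def constC₂ : ℝ := 442

/-- The upper bound imposed on the first step size `α₁`. -/
def firstStepBound (L : Vec p → ℝ) (β γ₁ γ₂ ε αmax α₁ : ℝ) : ℝ :=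
  min αmax (min (Real.log (1 + √ε / ‖gradient L 0‖))
    (Real.log (1 + (max (constC₁ L γ₁ α₁) (√2 * constC₂) * β * ‖gradient L 0‖) ^
      (-(1 / min (2 - γ₁) (1 - γ₂ / 2))))))

/-- The step size `α_{k+1}`, as a function of `α_k = α`, `t_k = t` and `θ_k = x`. -/
def nextStepSize (L : Vec p → ℝ) (β γ₁ γ₂ αmax α₁ α t : ℝ) (x : Vec p) : ℝ :=
  min αmax (min (2 * α) (min
    (Real.log (1 + Real.exp (t / 2) * (Real.exp α₁ - 1) * ‖gradient L 0‖ *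
      (1 - Real.exp (-t)) / ‖x‖))
    (Real.log (1 + (constC₂ * β * Real.exp t *
      max ((Real.exp t - 1) ^ (-γ₁)) ((Real.exp t - 1) ^ (-1 - γ₂ / 2)) * ‖x‖)⁻¹))))

/-- The state of the method after `k` steps: the grid point `t_k`, the iterate `θ_k`, and the
step size `α_{k+1}` to be used next. -/
structure State (p : ℕ) where
  time : ℝ
  iterate : Vec p
  stepSize : ℝ

/-- The sequence of states, starting with `t_0 = 0`, `θ_0 = 0` and the step size `α₁`. -/
def run (L : Vec p → ℝ) (β γ₁ γ₂ αmax α₁ : ℝ) : ℕ → State p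
  | 0 => ⟨0, 0, α₁⟩
  | k + 1 =>
    let s := run L β γ₁ γ₂ αmax α₁ k
    let t := s.time + s.stepSize
    let x := newtonStep L t s.iterate
    ⟨t, x, nextStepSize L β γ₁ γ₂ αmax α₁ s.stepSize t x⟩

/-- The termination criterion at the state `s`. -/
def Stops (L : Vec p → ℝ) (α₁ : ℝ) (tmax : EReal) (s : State p) : Prop :=
  tmax < (s.time : EReal) ∨
    2 * ‖s.iterate‖ ^ 2 / (Real.exp s.time - 1) ≤
      (Real.exp α₁ - 1) ^ 2 * ‖gradient L 0‖ ^ 2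

/-- The method terminates at step `N`: this is the first `N ≥ 1` at which the criterion holds. -/
def TerminatesAt (L : Vec p → ℝ) (α₁ : ℝ) (tmax : EReal) (s : ℕ → State p) (N : ℕ) : Prop :=
  1 ≤ N ∧ Stops L α₁ tmax (s N) ∧ ∀ k, 1 ≤ k → k < N → ¬ Stops L α₁ tmax (s k)

open Classical in
/-- The approximate path: linear interpolation of the iterates at the grid points
`t_0 < t_1 < ⋯ < t_N`, and constant equal to `θ_N` from `t_N` on. -/
def interpolation (s : ℕ → State p) (N : ℕ) (t : EReal) : Vec p :=
  let k := Nat.findGreatest (fun j => ((s j).time : EReal) ≤ t) N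
  if k = N then (s N).iterate
  else (((s (k + 1)).time - t.toReal) / ((s (k + 1)).time - (s k).time)) • (s k).iterate +
    ((t.toReal - (s k).time) / ((s (k + 1)).time - (s k).time)) • (s (k + 1)).iterate

end NewtonPath

end

/-! Put `s = e^t - 1`. Minimizing `f_t` is minimizing `e^t f_t = s L + ‖·‖²/2` (up to scale), which
is 1-strongly convex and has gradient `resid L s`. Two facts make this residual the quantity to
control. By strong convexity the gap of `f_t` is at most `e^{-t}/2 · ‖resid‖²`
(`IsLoss.objective_sub_le`). And since `(sλ)^γ ≤ (sλ+1)²` for `0 ≤ γ ≤ 2`, the spectral hypothesis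
on the Hessian turns one Newton step into `‖new resid‖ ≤ β s^{1-γ₁} ‖resid‖²`, valid once `β
s^{-γ₂/2} ‖resid‖ ≤ 1` (`IsLoss.newtonStep_bound`).

Let `D = (e^{α₁} - 1)‖∇L(0)‖`, so that `D² ≤ ε`. The invariant `NearPath` says that the residual is
a small multiple of `e^{t/2} D` and that its weighted size is small. Raising `t` to `t + α` replaces
the residual by `(s'/s) resid - (s'/s - 1) x`; the step rule keeps this within `O(e^{t/2} D)` and
inside the quadratic regime, so a single Newton step restores the invariant
(`IsLoss.nearPath_step`). Convexity of `f_τ` extends the endpoint bounds to each segment, with error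
at most `3 D²`.

Termination: without stopping, bounded times would mean bounded iterates, hence steps bounded below,
a contradiction; so the times are unbounded. For `tmax = ∞` a minimizer of `L` bounds the iterates
up to their residuals, and the second criterion must eventually hold.

After a stop by the second criterion, the final iterate stays at a distance from `0` fixed by `L`
(`norm_ge_of_stops`). Combined with `‖x‖ ≤ D √s` this forces `1/√s = O(D)`, and the remaining gap in
`L` is `O(D²)` (`IsLoss.sub_le_of_stops`). Those constants use only `L` and a bound on the solution
path, never `β`, `γ₁`, `γ₂`. -/

namespace NewtonPath

/-! ### Functional calculus of the Hessian -/

section OpPow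

open scoped MatrixOrder

variable {p : ℕ}

theorem posSemidef_toEuclideanCLM_symm {T : Vec p →L[ℝ] Vec p}
    (hs : ∀ x y, ⟪T x, y⟫ = ⟪x, T y⟫) (hp : ∀ x, 0 ≤ ⟪x, T x⟫) :
    ((Matrix.toEuclideanCLM (n := Fin p) (𝕜 := ℝ)).symm T).PosSemidef := by
  set A := (Matrix.toEuclideanCLM (n := Fin p) (𝕜 := ℝ)).symm T with hA
  have hT : Matrix.toEuclideanCLM (n := Fin p) (𝕜 := ℝ) A = T := by simp [hA]
  refine Matrix.PosSemidef.of_dotProduct_mulVec_nonneg ?_ fun x => ?_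
  · have h : star T = T := by
      rw [ContinuousLinearMap.star_eq_adjoint]
      exact (ContinuousLinearMap.eq_adjoint_iff _ _).2 hs |>.symm
    have h' : star A = A := by
      apply (Matrix.toEuclideanCLM (n := Fin p) (𝕜 := ℝ)).injective
      refine ((Matrix.toEuclideanCLM (n := Fin p) (𝕜 := ℝ)).map_star' A).trans ?_
      change star (Matrix.toEuclideanCLM (n := Fin p) (𝕜 := ℝ) A) = _
      rw [hT, h]
      exact hT.symm
    exact h'
  · have := hp (WithLp.toLp 2 x)
    rw [← hT, Matrix.inner_toEuclideanCLM] at this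
    simpa using this

theorem rpow_mul_rpow_le_sq {s x γ : ℝ} (hs : 0 < s) (hx : 0 ≤ x) (h0 : 0 ≤ γ) (h2 : γ ≤ 2) :
    s ^ γ * x ^ γ ≤ (s * x + 1) ^ 2 := by
  rw [← Real.mul_rpow hs.le hx]
  have hy : 0 ≤ s * x := by positivity
  calc (s * x) ^ γ ≤ (s * x + 1) ^ γ := Real.rpow_le_rpow hy (by linarith) h0
    _ ≤ (s * x + 1) ^ (2 : ℝ) := Real.rpow_le_rpow_of_exponent_le (by linarith) h2
    _ = (s * x + 1) ^ 2 := by norm_cast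

/-- `s^γ ⟪d, T^γ d⟫ ≤ ‖(s T + 1) d‖²` for `0 ≤ γ ≤ 2` and `T` positive semidefinite. -/
theorem rpow_mul_inner_opPow_le {T : Vec p →L[ℝ] Vec p}
    (hs : ∀ x y, ⟪T x, y⟫ = ⟪x, T y⟫) (hp : ∀ x, 0 ≤ ⟪x, T x⟫) {γ s : ℝ}
    (h0 : 0 ≤ γ) (h2 : γ ≤ 2) (hspos : 0 < s) (d : Vec p) :
    s ^ γ * ⟪d, opPow T γ d⟫ ≤ ‖s • T d + d‖ ^ 2 := by
  have hA := posSemidef_toEuclideanCLM_symm hs hp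
  set A := (Matrix.toEuclideanCLM (n := Fin p) (𝕜 := ℝ)).symm T with hAdef
  have hT : Matrix.toEuclideanCLM (n := Fin p) (𝕜 := ℝ) A = T := by simp [hAdef]
  have hsa : IsSelfAdjoint A := hA.1
  have hle : cfc (fun x : ℝ => s ^ γ * x ^ γ) A ≤ cfc (fun x : ℝ => (s * x + 1) ^ 2) A := by
    refine cfc_mono (fun x hx => ?_) ?_ ?_
    · exact rpow_mul_rpow_le_sq hspos
        (spectrum_nonneg_of_nonneg (Matrix.nonneg_iff_posSemidef.2 hA) hx) h0 h2
    -- The spectrum is finite, so continuity of the power on it is automatic.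
    · exact (Matrix.finite_real_spectrum).continuousOn _
    · fun_prop
  have e1 : cfc (fun x : ℝ => s ^ γ * x ^ γ) A = s ^ γ • cfc (fun x : ℝ => x ^ γ) A :=
    cfc_const_mul _ _ _ ((Matrix.finite_real_spectrum).continuousOn _)
  have e2 : cfc (fun x : ℝ => (s * x + 1) ^ 2) A = (s • A + 1) ^ 2 := by
    rw [cfc_pow (fun x : ℝ => s * x + 1) 2 A (by fun_prop) hsa,
      cfc_add_const 1 (fun x : ℝ => s * x) A (by fun_prop) hsa, cfc_const_mul_id s A hsa, map_one]
  rw [e1, e2] at hle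
  have := (Matrix.le_iff.1 hle).dotProduct_mulVec_nonneg (d : Fin p → ℝ)
  rw [star_trivial, ← Matrix.inner_toEuclideanCLM] at this
  have h3 : ⟪d, (Matrix.toEuclideanCLM (n := Fin p) (𝕜 := ℝ))
      ((s • A + 1) ^ 2 - s ^ γ • cfc (fun x : ℝ => x ^ γ) A) d⟫ =
      ‖s • T d + d‖ ^ 2 - s ^ γ * ⟪d, opPow T γ d⟫ := by
    rw [map_sub, map_pow, map_add, map_smul, map_one, hT, map_smul, pow_two]
    simp only [sub_apply, inner_sub_right, smul_apply,
      real_inner_smul_right, mul_apply_eq_comp, add_apply,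
      one_apply_eq_self, opPow, ← hAdef]
    congr 1
    rw [← real_inner_self_eq_norm_sq, inner_add_left, inner_add_right (𝕜 := ℝ) d,
      real_inner_smul_left, hs, real_inner_smul_right]
  linarith [h3 ▸ this]

end OpPow

/-! ### First order properties of the loss -/

variable {p : ℕ} {S : Set (Vec p)} {L : Vec p → ℝ}

theorem IsLoss.hasGradientAt (hL : IsLoss S L) {x : Vec p} (hx : x ∈ S) :
    HasGradientAt L (gradient L x) x :=
  (hL.differentiable x hx).hasGradientAt

theorem IsLoss.add_inner_le (hL : IsLoss S L) {x y : Vec p} (hx : x ∈ S) (hy : y ∈ S) :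
    L x + ⟪gradient L x, y - x⟫ ≤ L y := by
  have hc : ConvexOn ℝ (AffineMap.lineMap x y ⁻¹' S) (L ∘ AffineMap.lineMap (k := ℝ) x y) :=
    hL.convex.comp_affineMap _
  have hd : HasDerivAt (L ∘ AffineMap.lineMap (k := ℝ) x y) ⟪gradient L x, y - x⟫ 0 := by
    have h1 : HasFDerivAt L (innerSL ℝ (gradient L x)) (AffineMap.lineMap (k := ℝ) x y 0) := by
      rw [AffineMap.lineMap_apply_zero]
      exact (hL.hasGradientAt hx).hasFDerivAt
    have h2 := h1.comp_hasDerivAt (0 : ℝ) (AffineMap.hasDerivAt_lineMap (a := x) (b := y))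
    simpa using h2
  have := hc.le_slope_of_hasDerivAt (x := 0) (y := 1) (by simpa using hx) (by simpa using hy)
    one_pos hd
  simp only [slope_def_field, Function.comp_apply, AffineMap.lineMap_apply_one,
    AffineMap.lineMap_apply_zero, sub_zero, div_one] at this
  linarith

theorem IsLoss.inner_gradient_sub_nonneg (hL : IsLoss S L) {x y : Vec p} (hx : x ∈ S)
    (hy : y ∈ S) : 0 ≤ ⟪gradient L y - gradient L x, y - x⟫ := by
  have h1 := hL.add_inner_le hx hy
  have h2 := hL.add_inner_le hy hx
  have h3 : ⟪gradient L y, x - y⟫ = -⟪gradient L y, y - x⟫ := by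
    rw [← inner_neg_right, neg_sub]
  rw [inner_sub_left]
  linarith

theorem IsLoss.hess_symm (hL : IsLoss S L) {x : Vec p} (hx : x ∈ S) (v w : Vec p) :
    ⟪hess L x v, w⟫ = ⟪v, hess L x w⟫ := by
  have h1 : ∀ᶠ y in nhds x, HasFDerivAt L (innerSL ℝ (gradient L y)) y :=
    (hL.isOpen_dom.eventually_mem hx).mono fun y hy => (hL.hasGradientAt hy).hasFDerivAt
  have h2 : HasFDerivAt (fun y => innerSL ℝ (gradient L y))
      ((innerSL ℝ (E := Vec p)).comp (hess L x)) x :=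
    (innerSL ℝ (E := Vec p)).hasFDerivAt.comp x (hL.differentiable_gradient x hx).hasFDerivAt
  have := second_derivative_symmetric_of_eventually h1 h2 v w
  simp only [ContinuousLinearMap.comp_apply, innerSL_apply_apply] at this
  rw [this, real_inner_comm]

theorem IsLoss.hess_nonneg (hL : IsLoss S L) {x : Vec p} (hx : x ∈ S) (v : Vec p) :
    0 ≤ ⟪v, hess L x v⟫ := by
  have hd : HasDerivAt (fun u : ℝ => ⟪gradient L (x + u • v), v⟫) ⟪hess L x v, v⟫ 0 := by
    have h0 : HasDerivAt (fun u : ℝ => x + u • v) v 0 := by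
      simpa using ((hasDerivAt_id (0 : ℝ)).smul_const v).const_add x
    have h1 : HasFDerivAt (gradient L) (hess L x) (x + (0 : ℝ) • v) := by
      rw [zero_smul, add_zero]
      exact (hL.differentiable_gradient x hx).hasFDerivAt
    have h2 := (h1.comp_hasDerivAt (0 : ℝ) h0).inner ℝ (hasDerivAt_const (0 : ℝ) v)
    simpa using h2
  rw [real_inner_comm]
  have ht := hd.tendsto_slope_zero_right
  refine ge_of_tendsto ht ?_
  have hmem : ∀ᶠ u : ℝ in nhdsWithin 0 (Set.Ioi 0), x + u • v ∈ S := by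
    refine nhdsWithin_le_nhds ?_
    have : ContinuousAt (fun u : ℝ => x + u • v) 0 := by fun_prop
    exact this.eventually (hL.isOpen_dom.eventually_mem (by simpa using hx))
  filter_upwards [hmem, self_mem_nhdsWithin] with u hu hu0
  have hu0' : (0 : ℝ) < u := hu0
  have := hL.inner_gradient_sub_nonneg hx hu
  rw [add_sub_cancel_left, real_inner_smul_right, inner_sub_left] at this
  have h4 := nonneg_of_mul_nonneg_right this hu0'
  simp only [zero_add, zero_smul, add_zero, smul_eq_mul]
  positivity

/-- A segment that starts in the domain and along which the gradient stays bounded does not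
leave the domain. -/
theorem IsLoss.add_mem_of_gradient_bounded (hL : IsLoss S L) {x d : Vec p} (hx : x ∈ S) {B : ℝ}
    (hB : ∀ u ∈ Set.Icc (0 : ℝ) 1, x + u • d ∈ S → ‖gradient L (x + u • d)‖ ≤ B) :
    x + d ∈ S := by
  have hB0 : 0 ≤ B := (norm_nonneg _).trans (hB 0 (by simp) (by simpa using hx))
  set M := L x + B * ‖d‖
  have hbound : ∀ u ∈ Set.Icc (0 : ℝ) 1, x + u • d ∈ S → L (x + u • d) ≤ M := by
    intro u hu hmem
    have h1 := hL.add_inner_le hmem hx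
    have h2 : x - (x + u • d) = -(u • d) := by abel
    rw [h2, inner_neg_right] at h1
    have h3 := real_inner_le_norm (gradient L (x + u • d)) (u • d)
    have h4 : ‖u • d‖ ≤ ‖d‖ := by
      rw [norm_smul, Real.norm_of_nonneg hu.1]
      exact mul_le_of_le_one_left (norm_nonneg _) hu.2
    have h5 := mul_le_mul (hB u hu hmem) h4 (norm_nonneg _) hB0
    linarith
  have hcont : Continuous (fun u : ℝ => x + u • d) := by fun_prop
  -- Continuous induction on `[0, 1]`: this set is closed because the epigraph is, and it extends to
  -- the right because `S` is open and `hbound` supplies the bound at every point still in `S`.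
  set U : Set ℝ := {u | x + u • d ∈ S ∧ L (x + u • d) ≤ M}
  have hclosed : IsClosed U := by
    have : Continuous (fun u : ℝ => ((x + u • d, M) : Vec p × ℝ)) := by fun_prop
    exact hL.isClosed_epigraph.preimage this
  have hsub := IsClosed.Icc_subset_of_forall_exists_gt (a := (0 : ℝ)) (b := 1) (s := U)
    (hclosed.inter isClosed_Icc)
    ⟨by simpa using hx, hbound 0 (by simp) (by simpa using hx)⟩ ?_
  · have := (hsub (Set.right_mem_Icc.2 zero_le_one)).1
    simpa using this
  · rintro u ⟨⟨hu, -⟩, hu0, hu1⟩ y (hy : u < y)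
    have hev : ∀ᶠ z in nhdsWithin u (Set.Ioi u), x + z • d ∈ S :=
      nhdsWithin_le_nhds (hcont.continuousAt.eventually (hL.isOpen_dom.eventually_mem hu))
    have hev2 : ∀ᶠ z in nhdsWithin u (Set.Ioi u), z ∈ Set.Ioo u (min y 1) :=
      Ioo_mem_nhdsGT (lt_min hy hu1)
    obtain ⟨z, hz, hz1, hz2⟩ := (hev.and hev2).exists
    have hz3 := lt_min_iff.1 hz2
    exact ⟨z, ⟨hz, hbound z ⟨hu0.trans hz1.le, hz3.2.le⟩ hz⟩, hz1, hz3.1.le⟩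

/-! ### One Newton step -/

/-- The gradient of `e^t f_t = s L + ‖·‖² / 2` at `x`, where `s = e^t - 1`. -/
noncomputable def resid (L : Vec p → ℝ) (s : ℝ) (x : Vec p) : Vec p :=
  s • gradient L x + x

theorem norm_le_norm_smul_add {T : Vec p →L[ℝ] Vec p} (hp : ∀ x, 0 ≤ ⟪x, T x⟫) {s : ℝ}
    (hs : 0 ≤ s) (d : Vec p) : ‖d‖ ≤ ‖s • T d + d‖ := by
  have h1 := real_inner_le_norm d (s • T d + d)
  rw [inner_add_right, real_inner_smul_right, real_inner_self_eq_norm_sq] at h1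
  have h2 := mul_nonneg hs (hp d)
  by_contra! h
  have h3 : 0 < ‖d‖ := (norm_nonneg _).trans_lt h
  nlinarith

/-- `ContinuousLinearMap.inverse` takes the value zero at non-invertible operators, so the Newton
step only means something once this is known. Positive definiteness gives injectivity, and the
dimension is finite. -/
theorem isInvertible_newton {T : Vec p →L[ℝ] Vec p} (hp : ∀ x, 0 ≤ ⟪x, T x⟫) {a c : ℝ}
    (ha : 0 ≤ a) (hc : 0 < c) :
    (a • T + c • ContinuousLinearMap.id ℝ (Vec p)).IsInvertible := by
  set B := a • T + c • ContinuousLinearMap.id ℝ (Vec p) with hB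
  have hinj : Function.Injective (B : Vec p →ₗ[ℝ] Vec p) := by
    refine (injective_iff_map_eq_zero _).2 fun d hd => ?_
    have h0 : B d = 0 := hd
    have h1 : ⟪d, B d⟫ = a * ⟪d, T d⟫ + c * ‖d‖ ^ 2 := by
      simp [hB, inner_add_right, real_inner_smul_right]
    rw [h0, inner_zero_right] at h1
    have h2 := mul_nonneg ha (hp d)
    have h3 : ‖d‖ ^ 2 ≤ 0 := by
      by_contra! h
      have := mul_pos hc h
      linarith
    simpa using le_antisymm h3 (sq_nonneg _)
  refine ⟨(LinearEquiv.ofInjectiveEndo (B : Vec p →ₗ[ℝ] Vec p) hinj).toContinuousLinearEquiv, ?_⟩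
  ext d
  rfl

theorem IsLoss.newtonStep_equation (hL : IsLoss S L) {x : Vec p} (hx : x ∈ S) {t : ℝ}
    (ht : 0 ≤ t) :
    (Real.exp t - 1) • hess L x (newtonStep L t x - x) + (newtonStep L t x - x) =
      -resid L (Real.exp t - 1) x := by
  have hexp : Real.exp t * Real.exp (-t) = 1 := by rw [← Real.exp_add]; simp
  have hinv := isInvertible_newton (hL.hess_nonneg hx) (a := 1 - Real.exp (-t))
    (sub_nonneg.2 (Real.exp_le_one_iff.2 (by linarith))) (Real.exp_pos (-t))
  set B := (1 - Real.exp (-t)) • hess L x + Real.exp (-t) • ContinuousLinearMap.id ℝ (Vec p)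
    with hB
  set r := (1 - Real.exp (-t)) • gradient L x + Real.exp (-t) • x with hr
  have hd : newtonStep L t x - x = -B.inverse r := by
    rw [newtonStep, sub_sub_cancel_left]
  have h1 : B (newtonStep L t x - x) = -r := by
    rw [hd, map_neg, hinv.self_apply_inverse]
  have h2 : ∀ w z : Vec p, Real.exp t • ((1 - Real.exp (-t)) • w + Real.exp (-t) • z) =
      (Real.exp t - 1) • w + z := by
    intro w z
    rw [smul_add, smul_smul, smul_smul, hexp, one_smul, mul_sub, hexp, mul_one]
  have h3 : B (newtonStep L t x - x) = (1 - Real.exp (-t)) • hess L x (newtonStep L t x - x) +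
      Real.exp (-t) • (newtonStep L t x - x) := by
    simp [hB]
  rw [← h2, ← h3, h1, smul_neg, hr, h2, resid]

/-- The Newton equation `(s H + 1) d = -resid` and the spectral inequality give `⟪d, H^γ d⟫ ≤ s^{-γ}
‖resid‖²`. With `γ = γ₂` this places the step in the region where the Taylor bound applies; with `γ
= γ₁` it makes that bound quadratic in the residual. The same bound along the segment controls the
gradient and so keeps the segment in the domain. -/
theorem IsLoss.newtonStep_bound (hL : IsLoss S L) {β γ₁ γ₂ : ℝ}
    (hH : LocalLipschitzHessian S L β γ₁ γ₂) {x : Vec p} (hx : x ∈ S) {t s : ℝ} (ht : 0 < t)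
    (hs : s = Real.exp t - 1) (hsmall : β * s ^ (-(γ₂ / 2)) * ‖resid L s x‖ ≤ 1) :
    newtonStep L t x ∈ S ∧
      ‖resid L s (newtonStep L t x)‖ ≤ β * s ^ (1 - γ₁) * ‖resid L s x‖ ^ 2 ∧
      ‖newtonStep L t x - x‖ ≤ ‖resid L s x‖ := by
  have hspos : 0 < s := by rw [hs]; linarith [Real.add_one_lt_exp ht.ne']
  have hsym := hL.hess_symm hx
  have hpos := hL.hess_nonneg hx
  have heq := hL.newtonStep_equation hx ht.le
  rw [← hs] at heq
  set d := newtonStep L t x - x with hd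
  have hxd : newtonStep L t x = x + d := by rw [hd]; abel
  rw [hxd]
  set v := resid L s x with hv
  set H := hess L x
  have hnorm : ‖s • H d + d‖ = ‖v‖ := by rw [heq, norm_neg]
  have hdv : ‖d‖ ≤ ‖v‖ := hnorm ▸ norm_le_norm_smul_add hpos hspos.le d
  have hβ := hH.beta_pos
  have key : ∀ γ : ℝ, 0 ≤ γ → γ ≤ 2 → ∀ d' : Vec p,
      ⟪d', opPow H γ d'⟫ ≤ s ^ (-γ) * ‖s • H d' + d'‖ ^ 2 := by
    intro γ h0 h2 d'
    have := rpow_mul_inner_opPow_le hsym hpos h0 h2 hspos d'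
    rw [Real.rpow_neg hspos.le, inv_mul_eq_div, le_div_iff₀' (Real.rpow_pos_of_pos hspos _)]
    exact this
  have hu : ∀ u ∈ Set.Icc (0 : ℝ) 1, x + u • d ∈ S →
      ‖gradient L (x + u • d) - gradient L x - H (u • d)‖ ≤ β * (s ^ (-γ₁) * ‖v‖ ^ 2) := by
    intro u hu hmem
    have hscale : ‖s • H (u • d) + u • d‖ ^ 2 ≤ ‖v‖ ^ 2 := by
      have : s • H (u • d) + u • d = u • (s • H d + d) := by
        rw [map_smul, smul_add, smul_comm]
      rw [this, norm_smul, hnorm, Real.norm_of_nonneg hu.1]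
      exact pow_le_pow_left₀ (mul_nonneg hu.1 (norm_nonneg _))
        (mul_le_of_le_one_left (norm_nonneg _) hu.2) 2
    have h1 : ⟪u • d, opPow H γ₂ (u • d)⟫ ≤ (β ^ 2)⁻¹ := by
      refine (key γ₂ hH.gamma₂_nonneg hH.gamma₂_lt.le _).trans ?_
      refine (mul_le_mul_of_nonneg_left hscale (Real.rpow_nonneg hspos.le _)).trans ?_
      have h2 : s ^ (-γ₂) = (s ^ (-(γ₂ / 2))) ^ 2 := by
        rw [← Real.rpow_natCast, ← Real.rpow_mul hspos.le]
        norm_num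
      rw [h2, ← mul_pow, ← one_div, le_div_iff₀ (by positivity), ← mul_pow]
      refine pow_le_one₀ (by positivity) ?_
      linarith
    refine (hH.bound x hx _ hmem h1).trans (mul_le_mul_of_nonneg_left ?_ hβ.le)
    exact (key γ₁ hH.gamma₁_nonneg hH.gamma₁_lt.le _).trans
      (mul_le_mul_of_nonneg_left hscale (Real.rpow_nonneg hspos.le _))
  have hmem : x + d ∈ S := by
    refine hL.add_mem_of_gradient_bounded hx
      (B := β * (s ^ (-γ₁) * ‖v‖ ^ 2) + ‖gradient L x‖ + ‖H d‖) fun u hu' hm => ?_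
    have h1 := hu u hu' hm
    have h2 : gradient L (x + u • d) =
        (gradient L (x + u • d) - gradient L x - H (u • d)) + gradient L x + H (u • d) := by abel
    have h3 : ‖H (u • d)‖ ≤ ‖H d‖ := by
      rw [map_smul, norm_smul, Real.norm_of_nonneg hu'.1]
      exact mul_le_of_le_one_left (norm_nonneg _) hu'.2
    rw [h2]
    exact norm_add₃_le.trans (by linarith)
  refine ⟨hmem, ?_, hdv⟩
  have h1 := hu 1 (by simp) (by simpa using hmem)
  rw [one_smul] at h1
  -- The Newton equation cancels the linear part, leaving only the Taylor remainder.
  have h2 : resid L s (x + d) = s • (gradient L (x + d) - gradient L x - H d) := by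
    have h3 : resid L s (x + d) =
        s • (gradient L (x + d) - gradient L x - H d) + (s • H d + d + v) := by
      simp only [resid, hv, smul_sub]
      abel
    rw [h3, heq]
    simp
  rw [h2, norm_smul, Real.norm_of_nonneg hspos.le]
  calc s * ‖gradient L (x + d) - gradient L x - H d‖
      ≤ s * (β * (s ^ (-γ₁) * ‖v‖ ^ 2)) := mul_le_mul_of_nonneg_left h1 hspos.le
    _ = β * s ^ (1 - γ₁) * ‖v‖ ^ 2 := by
        rw [sub_eq_add_neg, Real.rpow_add hspos, Real.rpow_one]; ring

/-! ### The regularized objective -/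

theorem expNeg_coe (t : ℝ) : expNeg (t : EReal) = Real.exp (-t) := by
  rw [expNeg, ← EReal.coe_neg, EReal.exp_coe, ENNReal.toReal_ofReal (Real.exp_pos _).le]

theorem expNeg_top : expNeg ⊤ = 0 := by simp [expNeg]

theorem objective_coe (L : Vec p → ℝ) (t : ℝ) (x : Vec p) :
    objective L t x = (1 - Real.exp (-t)) * L x + Real.exp (-t) / 2 * ‖x‖ ^ 2 := by
  rw [objective, expNeg_coe]

theorem objective_top (L : Vec p → ℝ) (x : Vec p) : objective L ⊤ x = L x := by
  simp [objective, expNeg_top]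

theorem one_sub_exp_neg (t : ℝ) : 1 - Real.exp (-t) = Real.exp (-t) * (Real.exp t - 1) := by
  rw [mul_sub, ← Real.exp_add]
  simp

/-- Complete the square in the lower bound of a 1-strongly convex function by its gradient; the
discarded term is `‖resid + (y - x)‖²`. -/
theorem IsLoss.objective_sub_le (hL : IsLoss S L) {x y : Vec p} (hx : x ∈ S) (hy : y ∈ S)
    {t : ℝ} (ht : 0 ≤ t) :
    objective L t x - objective L t y ≤
      Real.exp (-t) / 2 * ‖resid L (Real.exp t - 1) x‖ ^ 2 := by
  rw [objective_coe, objective_coe, one_sub_exp_neg]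
  set s := Real.exp t - 1
  have hs : 0 ≤ s := by simpa [s] using ht
  have hc := Real.exp_pos (-t)
  set c := Real.exp (-t)
  have h1 := hL.add_inner_le hx hy
  have h2 : ‖resid L s x + (y - x)‖ ^ 2 =
      ‖resid L s x‖ ^ 2 + 2 * (s * ⟪gradient L x, y - x⟫ + ⟪x, y - x⟫) + ‖y - x‖ ^ 2 := by
    rw [norm_add_sq_real, resid, inner_add_left, real_inner_smul_left]
  have h3 : ‖y‖ ^ 2 = ‖x‖ ^ 2 + 2 * ⟪x, y - x⟫ + ‖y - x‖ ^ 2 := by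
    rw [← norm_add_sq_real, add_sub_cancel]
  have h4 := sq_nonneg ‖resid L s x + (y - x)‖
  have h5 := mul_le_mul_of_nonneg_left h1 hs
  have h6 : s * L x + ‖x‖ ^ 2 / 2 - (s * L y + ‖y‖ ^ 2 / 2) ≤ ‖resid L s x‖ ^ 2 / 2 := by
    nlinarith
  have h7 := mul_le_mul_of_nonneg_left h6 hc.le
  linarith

theorem IsLoss.convexOn_objective (hL : IsLoss S L) {t : ℝ} (ht : 0 ≤ t) :
    ConvexOn ℝ S (objective L t) := by
  have h1 : ConvexOn ℝ S fun x => (1 - Real.exp (-t)) * L x :=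
    hL.convex.smul (sub_nonneg.2 (Real.exp_le_one_iff.2 (by linarith)))
  have h2 : ConvexOn ℝ S fun x : Vec p => Real.exp (-t) / 2 * ‖x‖ ^ 2 :=
    ((convexOn_norm hL.convex.1).pow (fun _ _ => norm_nonneg _) 2).smul
      (div_nonneg (Real.exp_pos _).le zero_le_two)
  refine (h1.add h2).congr fun x _ => ?_
  rw [objective_coe]
  rfl

theorem IsLoss.norm_le_of_objective_le (hL : IsLoss S L) {x : Vec p} (hx : x ∈ S) {t : ℝ}
    (ht : 0 ≤ t) (h : objective L t x ≤ objective L t 0) :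
    ‖x‖ ≤ 2 * (Real.exp t - 1) * ‖gradient L 0‖ := by
  rw [objective_coe, objective_coe, one_sub_exp_neg] at h
  set s := Real.exp t - 1
  have hs : 0 ≤ s := by simpa [s] using ht
  have hc := Real.exp_pos (-t)
  have h1 := hL.add_inner_le hL.zero_mem hx
  rw [sub_zero] at h1
  have h2 := neg_le_of_abs_le (abs_real_inner_le_norm (gradient L 0) x)
  have h3 : s * L x + ‖x‖ ^ 2 / 2 ≤ s * L 0 := by
    refine le_of_mul_le_mul_left ?_ hc
    rw [norm_zero] at h
    linarith
  have h4 : s * (L 0 - L x) ≤ s * (‖gradient L 0‖ * ‖x‖) :=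
    mul_le_mul_of_nonneg_left (by linarith) hs
  rcases (norm_nonneg x).eq_or_lt with h0 | h0
  · rw [← h0]; positivity
  · nlinarith

theorem IsLoss.exists_isMinimizer (hL : IsLoss S L) {t : ℝ} (ht : 0 ≤ t) :
    ∃ x, IsMinimizer S L t x := by
  rcases ht.eq_or_lt with rfl | ht0
  · refine ⟨0, hL.zero_mem, fun y _ => ?_⟩
    simp only [objective_coe]
    simp
  set R := 2 * (Real.exp t - 1) * ‖gradient L 0‖
  -- For `t > 0` every point that does at least as well as `0` lies in this set, which is compact
  -- because the sublevel set of `L` is closed.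
  set K : Set (Vec p) := {x | x ∈ S ∧ L x ≤ L 0} ∩ Metric.closedBall 0 R
  have hclosed : IsClosed {x | x ∈ S ∧ L x ≤ L 0} := by
    have : Continuous fun x : Vec p => (x, L 0) := by fun_prop
    exact hL.isClosed_epigraph.preimage this
  have hK : IsCompact K := (isCompact_closedBall 0 R).inter_left hclosed
  have hR : 0 ≤ R := by
    have : 0 ≤ Real.exp t - 1 := by simpa using ht
    positivity
  have h0 : (0 : Vec p) ∈ K := ⟨⟨hL.zero_mem, le_rfl⟩, by simpa using hR⟩
  have hcont : ContinuousOn (objective L t) K := by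
    have h1 : ContinuousOn L K := fun x hx =>
      (hL.differentiable x hx.1.1).continuousAt.continuousWithinAt
    unfold objective
    fun_prop
  obtain ⟨x, hx, hmin⟩ := hK.exists_isMinOn ⟨0, h0⟩ hcont
  refine ⟨x, hx.1.1, fun y hy => ?_⟩
  by_cases hy0 : objective L t y ≤ objective L t 0
  · refine hmin ⟨⟨hy, ?_⟩, ?_⟩
    · rw [objective_coe, objective_coe, norm_zero] at hy0
      have ha : 0 < 1 - Real.exp (-t) := sub_pos.2 (Real.exp_lt_one_iff.2 (by linarith))
      have hc := Real.exp_pos (-t)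
      refine le_of_mul_le_mul_left ?_ ha
      have : 0 ≤ Real.exp (-t) / 2 * ‖y‖ ^ 2 := by positivity
      linarith
    · simpa using hL.norm_le_of_objective_le hy ht hy0
  · exact (hmin h0).trans (not_le.1 hy0).le

theorem IsLoss.isMinimizer_unique (hL : IsLoss S L) {t : ℝ} (ht : 0 ≤ t) {x y : Vec p}
    (hx : IsMinimizer S L t x) (hy : IsMinimizer S L t y) : x = y := by
  have hm : (1 / 2 : ℝ) • x + (1 / 2 : ℝ) • y ∈ S :=
    hL.convex.1 hx.1 hy.1 (by norm_num) (by norm_num) (by norm_num)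
  have h1 := hL.convex.2 hx.1 hy.1 (by norm_num : (0 : ℝ) ≤ 1 / 2)
    (by norm_num : (0 : ℝ) ≤ 1 / 2) (by norm_num)
  have h2 := hx.2 _ hm
  have h3 := hy.2 _ hm
  simp only [objective_coe] at h2 h3
  have h4 : ‖(1 / 2 : ℝ) • x + (1 / 2 : ℝ) • y‖ ^ 2 =
      ‖x‖ ^ 2 / 2 + ‖y‖ ^ 2 / 2 - ‖x - y‖ ^ 2 / 4 := by
    rw [norm_add_sq_real, norm_sub_sq_real, norm_smul, norm_smul, real_inner_smul_left,
      real_inner_smul_right]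
    norm_num
    ring
  rw [h4] at h2 h3
  have ha : 0 ≤ 1 - Real.exp (-t) := sub_nonneg.2 (Real.exp_le_one_iff.2 (by linarith))
  have hc := Real.exp_pos (-t)
  simp only [smul_eq_mul] at h1
  have h5 := mul_le_mul_of_nonneg_left h1 ha
  have h6 : Real.exp (-t) * ‖x - y‖ ^ 2 ≤ 0 := by linarith
  have h7 : ‖x - y‖ ^ 2 ≤ 0 := by
    by_contra! h
    have := mul_pos hc h
    linarith
  have h8 : ‖x - y‖ = 0 := by simpa using le_antisymm h7 (sq_nonneg _)
  exact sub_eq_zero.1 (norm_eq_zero.1 h8)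

/-- Existence makes the `epsilon` choice meaningful, and uniqueness makes its minimum-norm clause
automatic. -/
theorem IsLoss.isMinimizer_solutionPath (hL : IsLoss S L) {t : ℝ} (ht : 0 ≤ t) :
    IsMinimizer S L t (solutionPath S L t) := by
  obtain ⟨x, hx⟩ := hL.exists_isMinimizer ht
  have : IsPathPoint S L t x := ⟨hx, fun y hy => (hL.isMinimizer_unique ht hx hy ▸ le_rfl)⟩
  exact (Classical.epsilon_spec (p := IsPathPoint S L t) ⟨x, this⟩).1

/-! ### A priori bounds on near-stationary points -/

/-- Pair the residual with `x` and use monotonicity of the gradient. The bound grows with `s`, so it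
serves on bounded time intervals. -/
theorem IsLoss.norm_le_resid_add (hL : IsLoss S L) {x : Vec p} (hx : x ∈ S) {s : ℝ}
    (hs : 0 ≤ s) : ‖x‖ ≤ ‖resid L s x‖ + s * ‖gradient L 0‖ := by
  have h1 := mul_nonneg hs (hL.inner_gradient_sub_nonneg hL.zero_mem hx)
  rw [sub_zero, inner_sub_left] at h1
  have h2 : ⟪resid L s x, x⟫ = s * ⟪gradient L x, x⟫ + ‖x‖ ^ 2 := by
    rw [resid, inner_add_left, real_inner_smul_left, real_inner_self_eq_norm_sq]
  have h3 := real_inner_le_norm (resid L s x) x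
  have h4 := mul_le_mul_of_nonneg_left
    (neg_le_of_abs_le (abs_real_inner_le_norm (gradient L 0) x)) hs
  rcases (norm_nonneg x).eq_or_lt with h0 | h0
  · rw [← h0]; positivity
  · nlinarith

/-- Pair `resid - y` with `x - y`: the term in `∇L` has a favourable sign because `L y ≤ L x`. Apart
from the residual the bound is independent of `s`, as `tmax = ∞` requires. -/
theorem IsLoss.norm_le_resid_add_of_le (hL : IsLoss S L) {x y : Vec p} (hx : x ∈ S)
    (hy : y ∈ S) {s : ℝ} (hs : 0 ≤ s) (hmin : L y ≤ L x) :
    ‖x‖ ≤ ‖resid L s x‖ + 2 * ‖y‖ := by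
  have h1 := hL.add_inner_le hx hy
  have h2 : s * ⟪gradient L x, y - x⟫ ≤ 0 := mul_nonpos_of_nonneg_of_nonpos hs (by linarith)
  have h3 : ⟪resid L s x - y, x - y⟫ = -(s * ⟪gradient L x, y - x⟫) + ‖x - y‖ ^ 2 := by
    rw [resid, add_sub_assoc, inner_add_left, real_inner_smul_left, real_inner_self_eq_norm_sq,
      ← neg_sub y x, inner_neg_right]
    ring
  have h4 := real_inner_le_norm (resid L s x - y) (x - y)
  have h5 : ‖x - y‖ ≤ ‖resid L s x - y‖ := by
    rcases (norm_nonneg (x - y)).eq_or_lt with h0 | h0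
    · rw [← h0]; positivity
    · nlinarith
  have h6 := norm_sub_le (resid L s x) y
  have h7 := norm_sub_norm_le x y
  linarith

theorem resid_rescale (L : Vec p → ℝ) {s s' : ℝ} (hs : s ≠ 0) (x : Vec p) :
    resid L s' x = (s' / s) • resid L s x - (s' / s - 1) • x := by
  rw [resid, resid, smul_add, smul_smul, div_mul_cancel₀ _ hs, sub_smul, one_smul]
  abel

/-! ### Tracking invariants -/

/-- The weight by which the residuals are measured. -/
noncomputable def weight (γ₁ γ₂ s : ℝ) : ℝ :=
  max (s ^ (1 - γ₁)) (s ^ (-(γ₂ / 2)))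

theorem weight_pos {γ₁ γ₂ s : ℝ} (hs : 0 < s) : 0 < weight γ₁ γ₂ s :=
  lt_max_of_lt_left (Real.rpow_pos_of_pos hs _)

theorem rpow_le_div_mul_rpow {s s' e : ℝ} (hs : 0 < s) (hss : s ≤ s') (he : e ≤ 1) :
    s' ^ e ≤ s' / s * s ^ e := by
  have h1 : 1 ≤ s' / s := (one_le_div hs).2 hss
  have h2 : s' ^ e = (s' / s) ^ e * s ^ e := by
    rw [← Real.mul_rpow (by positivity) hs.le, div_mul_cancel₀ _ hs.ne']
  rw [h2]
  refine mul_le_mul_of_nonneg_right ?_ (Real.rpow_nonneg hs.le _)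
  simpa using Real.rpow_le_rpow_of_exponent_le h1 he

theorem weight_le_div_mul_weight {γ₁ γ₂ s s' : ℝ} (h1 : 0 ≤ γ₁) (h2 : 0 ≤ γ₂) (hs : 0 < s)
    (hss : s ≤ s') : weight γ₁ γ₂ s' ≤ s' / s * weight γ₁ γ₂ s := by
  have h : 0 ≤ s' / s := div_nonneg (hs.le.trans hss) hs.le
  refine max_le ?_ ?_
  · exact (rpow_le_div_mul_rpow hs hss (by linarith)).trans
      (mul_le_mul_of_nonneg_left (le_max_left _ _) h)
  · exact (rpow_le_div_mul_rpow hs hss (by linarith)).trans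
      (mul_le_mul_of_nonneg_left (le_max_right _ _) h)

/-- `x` follows the solution path at time `t` up to the tolerance `D`. -/
structure NearPath (S : Set (Vec p)) (L : Vec p → ℝ) (β γ₁ γ₂ D t : ℝ) (x : Vec p) : Prop where
  mem : x ∈ S
  resid_le : ‖resid L (Real.exp t - 1) x‖ ≤ 3 / 100 * (Real.exp (t / 2) * D)
  weighted_resid_le :
    442 * (β * weight γ₁ γ₂ (Real.exp t - 1) * ‖resid L (Real.exp t - 1) x‖) ≤ 3 / 100

/-- The step size `α` is small enough at `(t, x)`. -/
structure GoodStep (β γ₁ γ₂ D t α : ℝ) (x : Vec p) : Prop where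
  pos : 0 < α
  le_tenth : α ≤ 1 / 10
  le_two_mul : α ≤ 2 * t
  change_le : ((Real.exp (t + α) - 1) / (Real.exp t - 1) - 1) * ‖x‖ ≤ Real.exp (t / 2) * D
  weighted_change_le : 442 * (β * weight γ₁ γ₂ (Real.exp t - 1) *
    (((Real.exp (t + α) - 1) / (Real.exp t - 1) - 1) * ‖x‖)) ≤ 1

/-- The worst case is `t = 1/20`, `α = 1/10`. With `y = e^t`, below it the ratio is at most `(y³ -
1)/(y - 1) = y² + y + 1`; above it `(y q² - 1)/(y - 1)` with `q = e^{1/20}` decreases in `y`. Both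
stay under `3.2`. -/
theorem exp_add_sub_one_le {t α : ℝ} (ht : 0 < t) (hα : α ≤ 1 / 10) (hα2 : α ≤ 2 * t) :
    Real.exp (t + α) - 1 ≤ 16 / 5 * (Real.exp t - 1) := by
  rw [Real.exp_add]
  have hq1 : (1.05125 : ℝ) ≤ Real.exp (1 / 20) := by
    have := Real.quadratic_le_exp_of_nonneg (x := 1 / 20) (by norm_num)
    norm_num at this ⊢
    linarith
  have hq2 : Real.exp (1 / 20) ≤ 1.0527 := by
    have := Real.exp_bound_div_one_sub_of_interval (x := 1 / 20) (by norm_num) (by norm_num)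
    norm_num at this ⊢
    linarith
  have hα' : Real.exp α ≤ Real.exp (1 / 20) ^ 2 := by
    rw [← Real.exp_nat_mul]
    exact Real.exp_le_exp.2 (by norm_num; linarith)
  have hα2' : Real.exp α ≤ Real.exp t ^ 2 := by
    rw [← Real.exp_nat_mul]
    exact Real.exp_le_exp.2 (by norm_num; linarith)
  have h1 : 1 < Real.exp t := Real.one_lt_exp_iff.2 ht
  set y := Real.exp t
  set q := Real.exp (1 / 20)
  rcases le_total t (1 / 20) with h | h
  · have hy : y ≤ 1.0527 := (Real.exp_le_exp.2 h).trans hq2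
    have h2 : y * Real.exp α ≤ y * y ^ 2 := mul_le_mul_of_nonneg_left hα2' (by linarith)
    have h3 : y * (y + 1) ≤ 2.2 := by nlinarith
    have h4 := mul_le_mul_of_nonneg_left h3 (by linarith : (0 : ℝ) ≤ y - 1)
    linarith
  · have hy : q ≤ y := Real.exp_le_exp.2 h
    have h2 : y * Real.exp α ≤ y * q ^ 2 := mul_le_mul_of_nonneg_left hα' (by linarith)
    have h3 : q ^ 2 ≤ 1.10818 := by nlinarith
    nlinarith

/-- One Newton step with a good step size preserves the tracking invariants. -/
theorem IsLoss.nearPath_step (hL : IsLoss S L) {β γ₁ γ₂ D t α : ℝ} {x : Vec p}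
    (hH : LocalLipschitzHessian S L β γ₁ γ₂) (hD : 0 ≤ D) (ht : 0 < t)
    (hn : NearPath S L β γ₁ γ₂ D t x) (hg : GoodStep β γ₁ γ₂ D t α x) :
    NearPath S L β γ₁ γ₂ D (t + α) (newtonStep L (t + α) x) ∧
      ‖resid L (Real.exp (t + α) - 1) (newtonStep L (t + α) x)‖ ≤
        1 / 100 * (Real.exp (t / 2) * D) ∧
      ‖newtonStep L (t + α) x - x‖ ≤ 11 / 10 * (Real.exp (t / 2) * D) := by
  have hρ := exp_add_sub_one_le ht hg.le_tenth hg.le_two_mul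
  obtain ⟨hmem, hr1, hr2⟩ := hn
  obtain ⟨hα, -, -, hc1, hc2⟩ := hg
  have hs : 0 < Real.exp t - 1 := sub_pos.2 (Real.one_lt_exp_iff.2 ht)
  have hss : Real.exp t - 1 ≤ Real.exp (t + α) - 1 :=
    sub_le_sub_right (Real.exp_le_exp.2 (by linarith)) _
  have hE' : Real.exp (t / 2) * D ≤ Real.exp ((t + α) / 2) * D :=
    mul_le_mul_of_nonneg_right (Real.exp_le_exp.2 (by linarith)) hD
  have hE0 : 0 ≤ Real.exp (t / 2) * D := by positivity
  set E := Real.exp (t / 2) * D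
  set s := Real.exp t - 1
  set s' := Real.exp (t + α) - 1 with hs'
  have hs'0 : 0 < s' := hs.trans_le hss
  have hw := weight_pos (γ₁ := γ₁) (γ₂ := γ₂) hs
  have hww := weight_le_div_mul_weight hH.gamma₁_nonneg hH.gamma₂_nonneg hs hss
  have hβ := hH.beta_pos
  have hw1 : s' ^ (1 - γ₁) ≤ s' / s * weight γ₁ γ₂ s :=
    (rpow_le_div_mul_rpow hs hss (by linarith [hH.gamma₁_nonneg])).trans
      (mul_le_mul_of_nonneg_left (le_max_left _ _) (by positivity))
  have hw2 : s' ^ (-(γ₂ / 2)) ≤ weight γ₁ γ₂ s :=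
    (Real.rpow_le_rpow_of_nonpos hs hss (by linarith [hH.gamma₂_nonneg])).trans (le_max_right _ _)
  have hρ1 : 1 ≤ s' / s := (one_le_div hs).2 hss
  have hρ2 : s' / s ≤ 16 / 5 := (div_le_iff₀ hs).2 hρ
  set w := weight γ₁ γ₂ s
  have hbw : 0 < β * w := mul_pos hβ hw
  set V := ‖resid L s' x‖ with hV
  have hV0 : 0 ≤ V := norm_nonneg _
  have hVle : V ≤ 16 / 5 * ‖resid L s x‖ + (s' / s - 1) * ‖x‖ := by
    rw [hV, resid_rescale L hs.ne' x]
    refine (norm_sub_le _ _).trans ?_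
    rw [norm_smul, norm_smul, Real.norm_of_nonneg (by linarith : 0 ≤ s' / s),
      Real.norm_of_nonneg (by linarith : 0 ≤ s' / s - 1)]
    gcongr
  -- `1.096 = 3.2 · 0.03 + 1`: the old residual magnified by `s'/s`, plus the change allowed by the
  -- step rule.
  have hV1 : V ≤ 1.096 * E := by linarith
  have hV2 : 442 * (β * w * V) ≤ 1.096 := by
    have := mul_le_mul_of_nonneg_left hVle hbw.le
    linarith
  have hsmall : β * s' ^ (-(γ₂ / 2)) * V ≤ 1 := by
    have h1 : β * s' ^ (-(γ₂ / 2)) * V ≤ β * w * V := by gcongr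
    linarith
  obtain ⟨h1, h2, h3⟩ := hL.newtonStep_bound hH hmem (by linarith : 0 < t + α) hs' hsmall
  set x' := newtonStep L (t + α) x
  have hR : ‖resid L s' x'‖ ≤ 16 / 5 * (β * w * V) * V := by
    refine h2.trans ?_
    calc β * s' ^ (1 - γ₁) * V ^ 2 ≤ β * (s' / s * w) * V ^ 2 := by gcongr
      _ ≤ β * (16 / 5 * w) * V ^ 2 := by gcongr
      _ = 16 / 5 * (β * w * V) * V := by ring
  -- `3.2 · 1.096 / 442 < 0.00794`. The invariant then closes, since `0.00794 · 1.096 < 0.01` and,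
  -- with the weight growing by at most `3.2`, `3.2 · 0.00794 · 1.096 < 0.03`.
  have hR1 : ‖resid L s' x'‖ ≤ 0.00794 * V := by
    refine hR.trans (mul_le_mul_of_nonneg_right ?_ hV0)
    linarith
  refine ⟨⟨h1, ?_, ?_⟩, by linarith, by linarith⟩
  · linarith
  · have h4 : β * weight γ₁ γ₂ s' * ‖resid L s' x'‖ ≤ β * (16 / 5 * w) * (0.00794 * V) := by
      have : weight γ₁ γ₂ s' ≤ 16 / 5 * w := hww.trans (by gcongr)
      have := weight_pos (γ₁ := γ₁) (γ₂ := γ₂) hs'0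
      gcongr
    linarith

/-! ### Suboptimality along the segments. -/

theorem IsLoss.objective_combo_sub_le (hL : IsLoss S L) {x x' y : Vec p} (hx : x ∈ S)
    (hx' : x' ∈ S) {τ K a b : ℝ} (hτ : 0 ≤ τ) (ha : 0 ≤ a) (hb : 0 ≤ b) (hab : a + b = 1)
    (h : objective L τ x - objective L τ y ≤ K) (h' : objective L τ x' - objective L τ y ≤ K) :
    a • x + b • x' ∈ S ∧ objective L τ (a • x + b • x') - objective L τ y ≤ K := by
  refine ⟨hL.convex.1 hx hx' ha hb hab, ?_⟩
  have h1 := (hL.convexOn_objective hτ).2 hx hx' ha hb hab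
  simp only [smul_eq_mul] at h1
  have h2 := mul_le_mul_of_nonneg_left h ha
  have h3 := mul_le_mul_of_nonneg_left h' hb
  have h4 : a * (objective L τ x - objective L τ y) + b * (objective L τ x' - objective L τ y) =
      a * objective L τ x + b * objective L τ x' - objective L τ y := by
    linear_combination (-objective L τ y) * hab
  have h5 : a * K + b * K = K := by rw [← add_mul, hab, one_mul]
  linarith

/-- This explains the scale `e^{t/2} D` of the tolerance: its square is absorbed by the factor
`e^{-τ}` in the gap, leaving `D²` uniformly in time. -/
theorem IsLoss.objective_sub_le_of_resid_le (hL : IsLoss S L) {x y : Vec p} (hx : x ∈ S)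
    (hy : y ∈ S) {t τ D K : ℝ} (hτ : 0 ≤ τ) (htτ : t ≤ τ)
    (h : ‖resid L (Real.exp τ - 1) x‖ ≤ K * (Real.exp (t / 2) * D)) :
    objective L τ x - objective L τ y ≤ K ^ 2 / 2 * D ^ 2 := by
  refine (hL.objective_sub_le hx hy hτ).trans ?_
  have h1 := pow_le_pow_left₀ (norm_nonneg _) h 2
  have h2 : Real.exp (-τ) * Real.exp (t / 2) ^ 2 ≤ 1 := by
    rw [← Real.exp_nat_mul, ← Real.exp_add]
    exact Real.exp_le_one_iff.2 (by norm_num; linarith)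
  calc Real.exp (-τ) / 2 * ‖resid L (Real.exp τ - 1) x‖ ^ 2
      ≤ Real.exp (-τ) / 2 * (K * (Real.exp (t / 2) * D)) ^ 2 := by gcongr
    _ = (Real.exp (-τ) * Real.exp (t / 2) ^ 2) * (K ^ 2 / 2 * D ^ 2) := by ring
    _ ≤ 1 * (K ^ 2 / 2 * D ^ 2) := by gcongr
    _ = _ := one_mul _

/-- The suboptimality along the segment between two consecutive iterates. -/
theorem IsLoss.segment_error (hL : IsLoss S L) {β γ₁ γ₂ D t α : ℝ} {x : Vec p}
    (hH : LocalLipschitzHessian S L β γ₁ γ₂) (hD : 0 ≤ D) (ht : 0 < t)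
    (hn : NearPath S L β γ₁ γ₂ D t x) (hg : GoodStep β γ₁ γ₂ D t α x) {τ : ℝ} (h1 : t ≤ τ)
    (h2 : τ ≤ t + α) {y : Vec p} (hy : y ∈ S) {a b : ℝ} (ha : 0 ≤ a) (hb : 0 ≤ b)
    (hab : a + b = 1) :
    a • x + b • newtonStep L (t + α) x ∈ S ∧
      objective L τ (a • x + b • newtonStep L (t + α) x) - objective L τ y ≤ 3 * D ^ 2 := by
  obtain ⟨hn', hr', hd⟩ := hL.nearPath_step hH hD ht hn hg
  set x' := newtonStep L (t + α) x
  have hρ := exp_add_sub_one_le ht hg.le_tenth hg.le_two_mul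
  have hs : 0 < Real.exp t - 1 := sub_pos.2 (Real.one_lt_exp_iff.2 ht)
  have hs1 : Real.exp t - 1 ≤ Real.exp τ - 1 := sub_le_sub_right (Real.exp_le_exp.2 h1) _
  have hs2 : Real.exp τ - 1 ≤ Real.exp (t + α) - 1 := sub_le_sub_right (Real.exp_le_exp.2 h2) _
  have hτ : 0 ≤ τ := ht.le.trans h1
  have hE : 0 ≤ Real.exp (t / 2) * D := by positivity
  have hc := hg.change_le
  have hr := hn.resid_le
  have hD2 := sq_nonneg D
  refine hL.objective_combo_sub_le hn.mem hn'.mem hτ ha hb hab ?_ ?_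
  · refine (hL.objective_sub_le_of_resid_le (D := D) (K := 1.1) hn.mem hy hτ h1 ?_).trans (by linarith)
    set E := Real.exp (t / 2) * D
    set s := Real.exp t - 1
    set σ := Real.exp τ - 1
    set s' := Real.exp (t + α) - 1
    have hσ1 : 1 ≤ σ / s := (one_le_div hs).2 hs1
    have hσ2 : σ / s ≤ s' / s := by gcongr
    have hσ3 : s' / s ≤ 16 / 5 := (div_le_iff₀ hs).2 hρ
    rw [resid_rescale L hs.ne' x]
    refine (norm_sub_le _ _).trans ?_
    rw [norm_smul, norm_smul, Real.norm_of_nonneg (by linarith : 0 ≤ σ / s),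
      Real.norm_of_nonneg (by linarith : 0 ≤ σ / s - 1)]
    have h3 : σ / s * ‖resid L s x‖ ≤ 16 / 5 * ‖resid L s x‖ :=
      mul_le_mul_of_nonneg_right (hσ2.trans hσ3) (norm_nonneg _)
    have h4 : (σ / s - 1) * ‖x‖ ≤ (s' / s - 1) * ‖x‖ := by gcongr
    linarith
  -- `2.2` covers `0.01` from the new residual, `1` from the change at `x`, and `1.1` from `‖x' -
  -- x‖`, which enters because the step rule controls `‖x‖` rather than `‖x'‖`.
  · refine (hL.objective_sub_le_of_resid_le (D := D) (K := 2.2) hn'.mem hy hτ h1 ?_).trans (by linarith)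
    set E := Real.exp (t / 2) * D
    set s := Real.exp t - 1
    set σ := Real.exp τ - 1
    set s' := Real.exp (t + α) - 1
    have hσ : 0 < σ := hs.trans_le hs1
    have hs' : 0 < s' := hσ.trans_le hs2
    have hσ1 : σ / s' ≤ 1 := (div_le_one hs').2 hs2
    have hσ0 : 0 ≤ σ / s' := by positivity
    have hρ1 : 1 ≤ s' / s := (one_le_div hs).2 (hs1.trans hs2)
    -- From `s ≤ σ` and `ρ + 1/ρ ≥ 2` for `ρ = s'/s`.
    have hσ2 : 1 - σ / s' ≤ s' / s - 1 := by
      have h3 : s / s' ≤ σ / s' := by gcongr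
      have h4 : s / s' * (s' / s) = 1 := by field_simp
      nlinarith [div_pos hs hs']
    rw [resid_rescale L hs'.ne' x']
    refine (norm_sub_le _ _).trans ?_
    rw [norm_smul, norm_smul, Real.norm_of_nonneg hσ0, norm_sub_rev,
      Real.norm_of_nonneg (by linarith : 0 ≤ 1 - σ / s')]
    have h3 : σ / s' * ‖resid L s' x'‖ ≤ ‖resid L s' x'‖ :=
      mul_le_of_le_one_left (norm_nonneg _) hσ1
    have h4 : ‖x'‖ ≤ ‖x‖ + ‖x' - x‖ := by
      have := norm_add_le x (x' - x)
      rwa [add_sub_cancel] at this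
    have h5 : (1 - σ / s') * ‖x'‖ ≤ (s' / s - 1) * ‖x‖ + 1 * ‖x' - x‖ := by
      refine (mul_le_mul_of_nonneg_left h4 (by linarith)).trans ?_
      rw [mul_add]
      gcongr
      linarith
    linarith

/-- The first Newton step, from the origin. -/
theorem IsLoss.nearPath_first_step (hL : IsLoss S L) {β γ₁ γ₂ α a : ℝ}
    (hH : LocalLipschitzHessian S L β γ₁ γ₂) (hα : 0 < α) (ha : a = Real.exp α - 1)
    (h1 : β * (a * ‖gradient L 0‖) * a ^ (1 - γ₁) ≤ 1 / 600)
    (h2 : β * (a * ‖gradient L 0‖) * a ^ (-(γ₂ / 2)) ≤ 1 / 600) :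
    NearPath S L β γ₁ γ₂ (a * ‖gradient L 0‖) α (newtonStep L α 0) ∧
      ‖newtonStep L α 0‖ ≤ a * ‖gradient L 0‖ := by
  have ha0 : 0 < a := by rw [ha]; exact sub_pos.2 (Real.one_lt_exp_iff.2 hα)
  have hv : ‖resid L a 0‖ = a * ‖gradient L 0‖ := by
    rw [resid, add_zero, norm_smul, Real.norm_of_nonneg ha0.le]
  have hD0 : 0 ≤ a * ‖gradient L 0‖ := by positivity
  set D := a * ‖gradient L 0‖
  obtain ⟨hm, hr, hd⟩ := hL.newtonStep_bound hH hL.zero_mem hα ha (by rw [hv]; linarith)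
  rw [hv] at hr hd
  rw [sub_zero] at hd
  have hr' : ‖resid L a (newtonStep L α 0)‖ ≤ 1 / 600 * D := by
    refine hr.trans ?_
    calc β * a ^ (1 - γ₁) * D ^ 2 = β * D * a ^ (1 - γ₁) * D := by ring
      _ ≤ _ := by gcongr
  have hE : D ≤ Real.exp (α / 2) * D :=
    le_mul_of_one_le_left hD0 (Real.one_le_exp (by linarith))
  have hβ := hH.beta_pos
  refine ⟨⟨hm, ?_, ?_⟩, hd⟩
  · rw [← ha]
    linarith
  · rw [← ha]
    have hw : β * D * weight γ₁ γ₂ a ≤ 1 / 600 := by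
      rcases max_choice (a ^ (1 - γ₁)) (a ^ (-(γ₂ / 2))) with h | h <;>
        rw [weight, h] <;> assumption
    have hw0 := weight_pos (γ₁ := γ₁) (γ₂ := γ₂) ha0
    have : β * weight γ₁ γ₂ a * ‖resid L a (newtonStep L α 0)‖ ≤
        β * weight γ₁ γ₂ a * (1 / 600 * D) := by gcongr
    linarith

theorem IsLoss.first_segment_error (hL : IsLoss S L) {β γ₁ γ₂ α a : ℝ}
    (hα : 0 < α) (ha : a = Real.exp α - 1)
    (hn : NearPath S L β γ₁ γ₂ (a * ‖gradient L 0‖) α (newtonStep L α 0))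
    (hd : ‖newtonStep L α 0‖ ≤ a * ‖gradient L 0‖) (hα1 : α ≤ 1 / 10)
    {τ : ℝ} (h1 : 0 ≤ τ) (h2 : τ ≤ α) {y : Vec p} (hy : y ∈ S) {u v : ℝ} (hu : 0 ≤ u)
    (hv : 0 ≤ v) (huv : u + v = 1) :
    u • (0 : Vec p) + v • newtonStep L α 0 ∈ S ∧
      objective L τ (u • (0 : Vec p) + v • newtonStep L α 0) - objective L τ y ≤
        3 * (a * ‖gradient L 0‖) ^ 2 := by
  have ha0 : 0 < a := by rw [ha]; exact sub_pos.2 (Real.one_lt_exp_iff.2 hα)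
  have hs2 : Real.exp τ - 1 ≤ a := by rw [ha]; exact sub_le_sub_right (Real.exp_le_exp.2 h2) _
  have hs1 : 0 ≤ Real.exp τ - 1 := by simpa using h1
  have hr := hn.resid_le
  rw [← ha] at hr
  have hG := norm_nonneg (gradient L 0)
  have hD : 0 ≤ a * ‖gradient L 0‖ := by positivity
  have hD2 := sq_nonneg (a * ‖gradient L 0‖)
  have hexp : Real.exp (α / 2) ≤ 2 := by
    have := Real.exp_bound_div_one_sub_of_interval (x := α / 2) (by linarith) (by linarith)
    refine this.trans ?_
    rw [div_le_iff₀ (by linarith)]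
    linarith
  refine hL.objective_combo_sub_le hL.zero_mem hn.mem h1 hu hv huv ?_ ?_
  · refine (hL.objective_sub_le_of_resid_le (t := 0) (D := a * ‖gradient L 0‖)
      (K := 1) hL.zero_mem hy h1 h1 ?_).trans
      (by linarith)
    rw [resid, add_zero, norm_smul, Real.norm_of_nonneg hs1]
    simp only [zero_div, Real.exp_zero, one_mul]
    gcongr
  · refine (hL.objective_sub_le_of_resid_le (t := 0) (D := a * ‖gradient L 0‖)
      (K := 1.1) hn.mem hy h1 h1 ?_).trans
      (by linarith)
    set σ := Real.exp τ - 1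
    simp only [zero_div, Real.exp_zero, one_mul]
    have hσ1 : σ / a ≤ 1 := (div_le_one ha0).2 hs2
    have hσ0 : 0 ≤ σ / a := by positivity
    rw [resid_rescale L ha0.ne']
    refine (norm_sub_le _ _).trans ?_
    rw [norm_smul, norm_smul, Real.norm_of_nonneg hσ0, norm_sub_rev,
      Real.norm_of_nonneg (by linarith : 0 ≤ 1 - σ / a)]
    have h3 : σ / a * ‖resid L a (newtonStep L α 0)‖ ≤ ‖resid L a (newtonStep L α 0)‖ :=
      mul_le_of_le_one_left (norm_nonneg _) hσ1
    have h4 : (1 - σ / a) * ‖newtonStep L α 0‖ ≤ ‖newtonStep L α 0‖ :=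
      mul_le_of_le_one_left (norm_nonneg _) (by linarith)
    have h5 : Real.exp (α / 2) * (a * ‖gradient L 0‖) ≤ 2 * (a * ‖gradient L 0‖) := by gcongr
    linarith

/-! ### Step sizes -/

theorem exp_sub_one_le_of_le_log {α b : ℝ} (hb : 0 ≤ b) (h : α ≤ Real.log (1 + b)) :
    Real.exp α - 1 ≤ b := by
  have := (Real.le_log_iff_exp_le (by linarith)).1 h
  linarith

theorem log_one_add_pos {b : ℝ} (hb : 0 < b) : 0 < Real.log (1 + b) :=
  Real.log_pos (by linarith)

/-- The consequences of the bound on the first step size. -/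
theorem firstStepBound_spec {β γ₁ γ₂ ε αmax α₁ : ℝ} (hH : LocalLipschitzHessian S L β γ₁ γ₂)
    (hG : gradient L 0 ≠ 0) (hε : 0 < ε) (hmax : αmax ≤ 1 / 10) (hα : 0 < α₁)
    (h : α₁ ≤ firstStepBound L β γ₁ γ₂ ε αmax α₁) :
    α₁ ≤ 1 / 10 ∧ ((Real.exp α₁ - 1) * ‖gradient L 0‖) ^ 2 ≤ ε ∧
      β * ((Real.exp α₁ - 1) * ‖gradient L 0‖) * (Real.exp α₁ - 1) ^ (1 - γ₁) ≤ 1 / 600 ∧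
      β * ((Real.exp α₁ - 1) * ‖gradient L 0‖) * (Real.exp α₁ - 1) ^ (-(γ₂ / 2)) ≤ 1 / 600 := by
  obtain ⟨h1, h'⟩ := le_min_iff.1 h
  obtain ⟨h2, h3⟩ := le_min_iff.1 h'
  have hα1 : α₁ ≤ 1 / 10 := h1.trans hmax
  have hG0 : 0 < ‖gradient L 0‖ := norm_pos_iff.2 hG
  have ha0 : 0 < Real.exp α₁ - 1 := sub_pos.2 (Real.one_lt_exp_iff.2 hα)
  have ha1 : Real.exp α₁ - 1 ≤ 1 := by
    have := Real.exp_bound_div_one_sub_of_interval hα.le (by linarith : α₁ < 1)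
    have h4 : 1 / (1 - α₁) ≤ 2 := by
      rw [div_le_iff₀ (by linarith)]
      linarith
    linarith
  have hβ := hH.beta_pos
  have h2' := exp_sub_one_le_of_le_log (by positivity) h2
  -- The second branch suffices: `1.4 · 442 = 618.8`.
  have hC : (600 : ℝ) ≤ max (constC₁ L γ₁ α₁) (√2 * constC₂) := by
    refine le_max_of_le_right ?_
    have : (1.4 : ℝ) ≤ √2 := Real.le_sqrt_of_sq_le (by norm_num)
    rw [constC₂]
    linarith
  set X := max (constC₁ L γ₁ α₁) (√2 * constC₂) * β * ‖gradient L 0‖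
  have hXle : 600 * β * ‖gradient L 0‖ ≤ X :=
    mul_le_mul_of_nonneg_right (mul_le_mul_of_nonneg_right hC hβ.le) hG0.le
  have hX : 0 < X := lt_of_lt_of_le (by positivity) hXle
  have h3' := exp_sub_one_le_of_le_log (Real.rpow_nonneg hX.le _) h3
  set a := Real.exp α₁ - 1
  set m := min (2 - γ₁) (1 - γ₂ / 2)
  have hm : 0 < m := lt_min (by linarith [hH.gamma₁_lt]) (by linarith [hH.gamma₂_lt])
  have ham : a ^ m ≤ X⁻¹ := by
    refine (Real.rpow_le_rpow ha0.le h3' hm.le).trans_eq ?_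
    rw [← Real.rpow_mul hX.le, ← Real.rpow_neg_one]
    congr 1
    field_simp
  -- Since `a ≤ 1`, `a · a^e = a^{e+1} ≤ a^m ≤ X⁻¹`. The two exponents needed, `1 - γ₁` and `-γ₂/2`,
  -- give exactly the two entries of the minimum `m`.
  have hae : ∀ e : ℝ, m ≤ e + 1 → β * (a * ‖gradient L 0‖) * a ^ e ≤ 1 / 600 := by
    intro e he
    have h4 : a * a ^ e ≤ X⁻¹ := by
      have h5 : a * a ^ e = a ^ (e + 1) := by rw [Real.rpow_add ha0, Real.rpow_one, mul_comm]
      rw [h5]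
      exact (Real.rpow_le_rpow_of_exponent_ge ha0 ha1 he).trans ham
    have h6 : a * a ^ e * X ≤ 1 := by
      refine (mul_le_mul_of_nonneg_right h4 hX.le).trans_eq ?_
      exact inv_mul_cancel₀ hX.ne'
    have h7 : 0 ≤ a * a ^ e := mul_nonneg ha0.le (Real.rpow_nonneg ha0.le _)
    have h8 := mul_le_mul_of_nonneg_left hXle h7
    linarith
  refine ⟨hα1, ?_, hae _ ?_, hae _ ?_⟩
  · have h4 : a * ‖gradient L 0‖ ≤ √ε := (le_div_iff₀ hG0).1 h2'
    calc (a * ‖gradient L 0‖) ^ 2 ≤ √ε ^ 2 := by gcongr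
      _ = ε := Real.sq_sqrt hε.le
  · exact (min_le_left _ _).trans (by linarith)
  · exact (min_le_right _ _).trans (by linarith)

theorem nextStepSize_pos {β γ₁ γ₂ αmax α₁ α t : ℝ} {x : Vec p} (hβ : 0 < β)
    (hG : gradient L 0 ≠ 0) (hmax : 0 < αmax) (hα₁ : 0 < α₁) (hα : 0 < α) (ht : 0 < t)
    (hx : x ≠ 0) : 0 < nextStepSize L β γ₁ γ₂ αmax α₁ α t x := by
  have hG0 : 0 < ‖gradient L 0‖ := norm_pos_iff.2 hG
  have hx0 : 0 < ‖x‖ := norm_pos_iff.2 hx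
  have ha0 : 0 < Real.exp α₁ - 1 := sub_pos.2 (Real.one_lt_exp_iff.2 hα₁)
  have hs0 : 0 < Real.exp t - 1 := sub_pos.2 (Real.one_lt_exp_iff.2 ht)
  have hc0 : 0 < 1 - Real.exp (-t) := sub_pos.2 (Real.exp_lt_one_iff.2 (by linarith))
  have hM : 0 < max ((Real.exp t - 1) ^ (-γ₁)) ((Real.exp t - 1) ^ (-1 - γ₂ / 2)) :=
    lt_max_of_lt_left (Real.rpow_pos_of_pos hs0 _)
  have hC : 0 < constC₂ := by rw [constC₂]; norm_num
  refine lt_min hmax (lt_min (by linarith) (lt_min ?_ ?_)) <;> apply log_one_add_pos <;> positivity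

theorem goodStep_nextStepSize {β γ₁ γ₂ αmax α₁ α t : ℝ} {x : Vec p} (hβ : 0 < β)
    (hG : gradient L 0 ≠ 0) (hmax : 0 < αmax) (hmax' : αmax ≤ 1 / 10) (hα₁ : 0 < α₁)
    (hα : 0 < α) (ht : 0 < t) (hαt : α ≤ t) (hx : x ≠ 0) :
    GoodStep β γ₁ γ₂ ((Real.exp α₁ - 1) * ‖gradient L 0‖) t
      (nextStepSize L β γ₁ γ₂ αmax α₁ α t x) x := by
  have hpos := nextStepSize_pos (γ₁ := γ₁) (γ₂ := γ₂) hβ hG hmax hα₁ hα ht hx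
  obtain ⟨h1, h'⟩ := le_min_iff.1 (le_refl (nextStepSize L β γ₁ γ₂ αmax α₁ α t x))
  obtain ⟨h2, h'⟩ := le_min_iff.1 h'
  obtain ⟨h3, h4⟩ := le_min_iff.1 h'
  have hG0 : 0 < ‖gradient L 0‖ := norm_pos_iff.2 hG
  have hx0 : 0 < ‖x‖ := norm_pos_iff.2 hx
  have ha0 : 0 < Real.exp α₁ - 1 := sub_pos.2 (Real.one_lt_exp_iff.2 hα₁)
  have hs0 : 0 < Real.exp t - 1 := sub_pos.2 (Real.one_lt_exp_iff.2 ht)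
  have hc0 : 0 < 1 - Real.exp (-t) := sub_pos.2 (Real.exp_lt_one_iff.2 (by linarith))
  have hM : 0 < max ((Real.exp t - 1) ^ (-γ₁)) ((Real.exp t - 1) ^ (-1 - γ₂ / 2)) :=
    lt_max_of_lt_left (Real.rpow_pos_of_pos hs0 _)
  have hC : 0 < constC₂ := by rw [constC₂]; norm_num
  have h3' := exp_sub_one_le_of_le_log (by positivity) h3
  have h4' := exp_sub_one_le_of_le_log (by positivity) h4
  set α' := nextStepSize L β γ₁ γ₂ αmax α₁ α t x
  have hratio : (Real.exp (t + α') - 1) / (Real.exp t - 1) - 1 =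
      Real.exp t * (Real.exp α' - 1) / (Real.exp t - 1) := by
    rw [Real.exp_add]
    field_simp
    ring
  -- The maximum in the step rule is the weight divided by `s`; that `s` cancels the denominator in
  -- `hratio`.
  have hw : weight γ₁ γ₂ (Real.exp t - 1) = (Real.exp t - 1) *
      max ((Real.exp t - 1) ^ (-γ₁)) ((Real.exp t - 1) ^ (-1 - γ₂ / 2)) := by
    have e : ∀ e : ℝ, (Real.exp t - 1) * (Real.exp t - 1) ^ e = (Real.exp t - 1) ^ (1 + e) := by
      intro e
      rw [Real.rpow_add hs0, Real.rpow_one]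
    rw [mul_max_of_nonneg _ _ hs0.le, e, e, weight]
    congr 2
    ring
  refine ⟨hpos, h1.trans hmax', by linarith, ?_, ?_⟩ <;> rw [hratio]
  · rw [le_div_iff₀ hx0] at h3'
    rw [div_mul_eq_mul_div, div_le_iff₀ hs0]
    have h5 := mul_le_mul_of_nonneg_left h3' (Real.exp_pos t).le
    have h6 : Real.exp t * (1 - Real.exp (-t)) = Real.exp t - 1 := by
      rw [mul_sub, ← Real.exp_add]
      simp
    rw [← h6]
    linarith
  · rw [hw]
    set M := max ((Real.exp t - 1) ^ (-γ₁)) ((Real.exp t - 1) ^ (-1 - γ₂ / 2))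
    rw [← one_div, le_div_iff₀ (by positivity), constC₂] at h4'
    calc 442 * (β * ((Real.exp t - 1) * M) *
          (Real.exp t * (Real.exp α' - 1) / (Real.exp t - 1) * ‖x‖))
        = (Real.exp α' - 1) * (442 * β * Real.exp t * M * ‖x‖) := by
          field_simp
      _ ≤ 1 := h4'

/-- Away from `t = 0`, the step size does not degenerate as long as the iterates are bounded. -/
theorem exists_le_nextStepSize {β γ₁ γ₂ αmax α₁ : ℝ} (hH : LocalLipschitzHessian S L β γ₁ γ₂)
    (hG : gradient L 0 ≠ 0) (hmax : 0 < αmax) (hα₁ : 0 < α₁) {T B : ℝ} (hB : 0 < B) :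
    ∃ c > 0, c ≤ α₁ ∧ ∀ α t : ℝ, ∀ x : Vec p, α₁ ≤ t → t ≤ T → x ≠ 0 → ‖x‖ ≤ B → c ≤ α →
      c ≤ nextStepSize L β γ₁ γ₂ αmax α₁ α t x := by
  have hG0 : 0 < ‖gradient L 0‖ := norm_pos_iff.2 hG
  have ha0 : 0 < Real.exp α₁ - 1 := sub_pos.2 (Real.one_lt_exp_iff.2 hα₁)
  have hc0 : 0 < 1 - Real.exp (-α₁) := sub_pos.2 (Real.exp_lt_one_iff.2 (by linarith))
  have hC : 0 < constC₂ := by rw [constC₂]; norm_num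
  have hβ := hH.beta_pos
  have hM1 : 0 < max ((Real.exp α₁ - 1) ^ (-γ₁)) ((Real.exp α₁ - 1) ^ (-1 - γ₂ / 2)) :=
    lt_max_of_lt_left (Real.rpow_pos_of_pos ha0 _)
  set c₃ := Real.log (1 + 1 * (Real.exp α₁ - 1) * ‖gradient L 0‖ * (1 - Real.exp (-α₁)) / B)
    with hc₃
  set c₄ := Real.log (1 + (constC₂ * β * Real.exp T *
    max ((Real.exp α₁ - 1) ^ (-γ₁)) ((Real.exp α₁ - 1) ^ (-1 - γ₂ / 2)) * B)⁻¹) with hc₄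
  have h3 : 0 < c₃ := log_one_add_pos (by positivity)
  have h4 : 0 < c₄ := log_one_add_pos (by positivity)
  have hc : 0 < min αmax (min c₃ c₄) := lt_min hmax (lt_min h3 h4)
  refine ⟨min α₁ (min αmax (min c₃ c₄)), lt_min hα₁ hc, min_le_left _ _, fun α t x h1t htT hx hxB hα => ?_⟩
  have hx0 : 0 < ‖x‖ := norm_pos_iff.2 hx
  have ht : 0 < t := hα₁.trans_le h1t
  have hs : Real.exp α₁ - 1 ≤ Real.exp t - 1 := sub_le_sub_right (Real.exp_le_exp.2 h1t) _
  have hs0 : 0 < Real.exp t - 1 := ha0.trans_le hs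
  have hM : 0 < max ((Real.exp t - 1) ^ (-γ₁)) ((Real.exp t - 1) ^ (-1 - γ₂ / 2)) :=
    lt_max_of_lt_left (Real.rpow_pos_of_pos hs0 _)
  refine le_min ((min_le_right _ _).trans (min_le_left _ _)) (le_min ?_
    ((min_le_right _ _).trans ((min_le_right _ _).trans (le_min ?_ ?_))))
  · have := lt_min hα₁ hc
    linarith
  · refine (min_le_left _ _).trans ?_
    rw [hc₃]
    have h5 : 1 ≤ Real.exp (t / 2) := Real.one_le_exp (by linarith)
    have h6 : 1 - Real.exp (-α₁) ≤ 1 - Real.exp (-t) :=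
      sub_le_sub_left (Real.exp_le_exp.2 (by linarith)) _
    have h7 : 0 ≤ 1 - Real.exp (-t) := hc0.le.trans h6
    gcongr
  · refine (min_le_right _ _).trans ?_
    rw [hc₄]
    have h5 : (Real.exp t - 1) ^ (-γ₁) ≤ (Real.exp α₁ - 1) ^ (-γ₁) :=
      Real.rpow_le_rpow_of_nonpos ha0 hs (by linarith [hH.gamma₁_nonneg])
    have h6 : (Real.exp t - 1) ^ (-1 - γ₂ / 2) ≤ (Real.exp α₁ - 1) ^ (-1 - γ₂ / 2) :=
      Real.rpow_le_rpow_of_nonpos ha0 hs (by linarith [hH.gamma₂_nonneg])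
    have h7 := max_le_max h5 h6
    gcongr

/-! ### The run of the method -/

theorem run_succ_time (β γ₁ γ₂ αmax α₁ : ℝ) (k : ℕ) :
    (run L β γ₁ γ₂ αmax α₁ (k + 1)).time =
      (run L β γ₁ γ₂ αmax α₁ k).time + (run L β γ₁ γ₂ αmax α₁ k).stepSize := rfl

theorem run_succ_iterate (β γ₁ γ₂ αmax α₁ : ℝ) (k : ℕ) :
    (run L β γ₁ γ₂ αmax α₁ (k + 1)).iterate =
      newtonStep L ((run L β γ₁ γ₂ αmax α₁ k).time + (run L β γ₁ γ₂ αmax α₁ k).stepSize)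
        (run L β γ₁ γ₂ αmax α₁ k).iterate := rfl

theorem run_succ_stepSize (β γ₁ γ₂ αmax α₁ : ℝ) (k : ℕ) :
    (run L β γ₁ γ₂ αmax α₁ (k + 1)).stepSize =
      nextStepSize L β γ₁ γ₂ αmax α₁ (run L β γ₁ γ₂ αmax α₁ k).stepSize
        (run L β γ₁ γ₂ αmax α₁ (k + 1)).time (run L β γ₁ γ₂ αmax α₁ (k + 1)).iterate := rfl

/-- At a zero iterate the step rule would divide by zero and return `log 1 = 0`; such an iterate
already meets the second criterion. -/
theorem iterate_ne_zero_of_not_stops {α₁ : ℝ} {tmax : EReal} {s : State p}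
    (h : ¬ Stops L α₁ tmax s) : s.iterate ≠ 0 := by
  intro h0
  refine h (Or.inr ?_)
  rw [h0, norm_zero]
  simp only [ne_eq, OfNat.ofNat_ne_zero, not_false_eq_true, zero_pow, mul_zero, zero_div]
  positivity

/-- The invariants of the method at the state `s`. -/
structure Invariant (S : Set (Vec p)) (L : Vec p → ℝ) (β γ₁ γ₂ α₁ : ℝ) (s : State p) : Prop where
  nearPath : NearPath S L β γ₁ γ₂ ((Real.exp α₁ - 1) * ‖gradient L 0‖) s.time s.iterate
  le_time : α₁ ≤ s.time
  goodStep : s.iterate ≠ 0 →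
    GoodStep β γ₁ γ₂ ((Real.exp α₁ - 1) * ‖gradient L 0‖) s.time s.stepSize s.iterate

/-- The parameters of a run, with the consequences of the choice of the first step size. -/
structure Admissible (S : Set (Vec p)) (L : Vec p → ℝ) (β γ₁ γ₂ αmax α₁ : ℝ) : Prop where
  lipschitz : LocalLipschitzHessian S L β γ₁ γ₂
  gradient_ne : gradient L 0 ≠ 0
  max_pos : 0 < αmax
  max_le : αmax ≤ 1 / 10
  first_pos : 0 < α₁
  first_le : α₁ ≤ 1 / 10
  first_bound₁ :
    β * ((Real.exp α₁ - 1) * ‖gradient L 0‖) * (Real.exp α₁ - 1) ^ (1 - γ₁) ≤ 1 / 600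
  first_bound₂ :
    β * ((Real.exp α₁ - 1) * ‖gradient L 0‖) * (Real.exp α₁ - 1) ^ (-(γ₂ / 2)) ≤ 1 / 600

section Run

variable {β γ₁ γ₂ αmax α₁ : ℝ}

theorem Admissible.tolerance_pos (hA : Admissible S L β γ₁ γ₂ αmax α₁) :
    0 < (Real.exp α₁ - 1) * ‖gradient L 0‖ :=
  mul_pos (sub_pos.2 (Real.one_lt_exp_iff.2 hA.first_pos)) (norm_pos_iff.2 hA.gradient_ne)

theorem Admissible.first_step (hL : IsLoss S L) (hA : Admissible S L β γ₁ γ₂ αmax α₁) :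
    NearPath S L β γ₁ γ₂ ((Real.exp α₁ - 1) * ‖gradient L 0‖) α₁ (newtonStep L α₁ 0) ∧
      ‖newtonStep L α₁ 0‖ ≤ (Real.exp α₁ - 1) * ‖gradient L 0‖ :=
  hL.nearPath_first_step hA.lipschitz hA.first_pos rfl hA.first_bound₁ hA.first_bound₂

theorem Admissible.invariant (hL : IsLoss S L) (hA : Admissible S L β γ₁ γ₂ αmax α₁)
    {tmax : EReal} (k : ℕ)
    (hk : ∀ j, 1 ≤ j → j < k + 1 → ¬ Stops L α₁ tmax (run L β γ₁ γ₂ αmax α₁ j)) :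
    Invariant S L β γ₁ γ₂ α₁ (run L β γ₁ γ₂ αmax α₁ (k + 1)) := by
  induction k with
  | zero =>
    have ht : (run L β γ₁ γ₂ αmax α₁ 1).time = α₁ := zero_add _
    have hx : (run L β γ₁ γ₂ αmax α₁ 1).iterate = newtonStep L α₁ 0 := by
      rw [run_succ_iterate]
      change newtonStep L (0 + α₁) 0 = _
      rw [zero_add]
    refine ⟨?_, ?_, fun h => ?_⟩
    · rw [zero_add, ht, hx]
      exact (hA.first_step hL).1
    · rw [zero_add, ht]
    · rw [run_succ_stepSize]
      refine goodStep_nextStepSize hA.lipschitz.beta_pos hA.gradient_ne hA.max_pos hA.max_le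
        hA.first_pos hA.first_pos ?_ ?_ h
      · rw [zero_add, ht]; exact hA.first_pos
      · rw [zero_add, ht]; exact le_rfl
  | succ k ih =>
    have hi := ih fun j h1 h2 => hk j h1 (by omega)
    have hg := hi.goodStep (iterate_ne_zero_of_not_stops (hk (k + 1) (by omega) (by omega)))
    have ht : 0 < (run L β γ₁ γ₂ αmax α₁ (k + 1)).time := hA.first_pos.trans_le hi.le_time
    have hstep := hL.nearPath_step hA.lipschitz hA.tolerance_pos.le ht hi.nearPath hg
    have hα := hg.pos
    refine ⟨hstep.1, ?_, fun h => ?_⟩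
    · rw [run_succ_time]
      linarith [hi.le_time]
    -- The step just taken is at most the time just reached, so the doubling rule gives a next step
    -- of at most `2 t`.
    · rw [run_succ_stepSize _ _ _ _ _ (k + 1)]
      refine goodStep_nextStepSize hA.lipschitz.beta_pos hA.gradient_ne hA.max_pos hA.max_le
        hA.first_pos hα ?_ ?_ h <;> rw [run_succ_time _ _ _ _ _ (k + 1)] <;> linarith

/-! ### Termination. -/

theorem Admissible.not_bounded (hL : IsLoss S L) (hA : Admissible S L β γ₁ γ₂ αmax α₁)
    {tmax : EReal} (hk : ∀ j, 1 ≤ j → ¬ Stops L α₁ tmax (run L β γ₁ γ₂ αmax α₁ j)) (T : ℝ) :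
    ∃ k, T < (run L β γ₁ γ₂ αmax α₁ (k + 1)).time := by
  by_contra! hT
  have hinv : ∀ k, Invariant S L β γ₁ γ₂ α₁ (run L β γ₁ γ₂ αmax α₁ (k + 1)) :=
    fun k => hA.invariant hL k fun j h1 _ => hk j h1
  have hne : ∀ k, (run L β γ₁ γ₂ αmax α₁ (k + 1)).iterate ≠ 0 :=
    fun k => iterate_ne_zero_of_not_stops (hk (k + 1) (by omega))
  have hD := hA.tolerance_pos
  set D := (Real.exp α₁ - 1) * ‖gradient L 0‖ with hDdef
  set B := 3 / 100 * (Real.exp (T / 2) * D) + (Real.exp T - 1) * ‖gradient L 0‖ with hB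
  have hxB : ∀ k, ‖(run L β γ₁ γ₂ αmax α₁ (k + 1)).iterate‖ ≤ B := by
    intro k
    have hs : 0 ≤ Real.exp (run L β γ₁ γ₂ αmax α₁ (k + 1)).time - 1 := by
      simpa using hA.first_pos.le.trans (hinv k).le_time
    refine (hL.norm_le_resid_add (hinv k).nearPath.mem hs).trans
      (add_le_add ((hinv k).nearPath.resid_le.trans ?_) ?_)
    · have := Real.exp_le_exp.2 (div_le_div_of_nonneg_right (hT k) zero_le_two)
      rw [← hDdef]
      gcongr
    · have := Real.exp_le_exp.2 (hT k)
      gcongr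
  have hB0 : 0 < B := (norm_pos_iff.2 (hne 0)).trans_le (hxB 0)
  obtain ⟨c, hc0, hc1, hc⟩ := exists_le_nextStepSize (T := T) hA.lipschitz hA.gradient_ne
    hA.max_pos hA.first_pos hB0
  have hstep : ∀ k, c ≤ (run L β γ₁ γ₂ αmax α₁ k).stepSize := by
    intro k
    induction k with
    | zero => exact hc1
    | succ k ih =>
      rw [run_succ_stepSize]
      exact hc _ _ _ (hinv k).le_time (hT k) (hne k) (hxB k) ih
  have htime : ∀ k : ℕ, k * c ≤ (run L β γ₁ γ₂ αmax α₁ k).time := by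
    intro k
    induction k with
    | zero => rw [Nat.cast_zero, zero_mul]; exact le_rfl
    | succ k ih =>
      rw [run_succ_time]
      push_cast
      linarith [hstep k]
  obtain ⟨n, hn⟩ := exists_nat_gt (T / c)
  rw [div_lt_iff₀ hc0] at hn
  have h1 := htime (n + 1)
  have h2 := hT n
  push_cast at h1
  linarith

/-- Bounds the times at which the second criterion can fail when `L` has a minimizer `y`. Later than
this, `2‖y‖ ≤ 0.02 e^{t/2} D`, so `‖x‖ ≤ 0.05 e^{t/2} D`; as `e^t ≥ 4`, that contradicts failure of
the criterion. -/
theorem bounded_of_minimizer (hL : IsLoss S L) {y : Vec p} (hy : y ∈ S)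
    (hmin : ∀ z ∈ S, L y ≤ L z) {D t : ℝ} {x : Vec p} (hD : 0 < D) (ht : 0 < t)
    (hn : NearPath S L β γ₁ γ₂ D t x) (hx : D ^ 2 < 2 * ‖x‖ ^ 2 / (Real.exp t - 1)) :
    t ≤ 2 * Real.log (2 + 100 * ‖y‖ / D) := by
  have hs : 0 < Real.exp t - 1 := sub_pos.2 (Real.one_lt_exp_iff.2 ht)
  have h1 := hL.norm_le_resid_add_of_le hn.mem hy hs.le (hmin x hn.mem)
  have h2 := hn.resid_le
  have hE : Real.exp t = Real.exp (t / 2) ^ 2 := by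
    rw [← Real.exp_nat_mul]
    congr 1
    norm_num
    ring
  have hE0 := Real.exp_pos (t / 2)
  have hpos : 0 < 2 + 100 * ‖y‖ / D := by positivity
  by_contra! h
  have h3 : 2 + 100 * ‖y‖ / D < Real.exp (t / 2) :=
    (Real.log_lt_iff_lt_exp hpos).1 (by linarith)
  rw [lt_div_iff₀ hs, hE] at hx
  set E := Real.exp (t / 2)
  have h4 : 2 * D + 100 * ‖y‖ < E * D := by
    have := mul_lt_mul_of_pos_right h3 hD
    rwa [add_mul, div_mul_cancel₀ _ hD.ne'] at this
  have h5 : ‖x‖ ≤ 1 / 20 * (E * D) := by linarith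
  have h6 : ‖x‖ ^ 2 ≤ (1 / 20 * (E * D)) ^ 2 := by gcongr
  have h7 : (2 : ℝ) ^ 2 ≤ E ^ 2 := by
    have : 0 ≤ 100 * ‖y‖ / D := by positivity
    exact pow_le_pow_left₀ zero_le_two (by linarith) 2
  have h8 := mul_le_mul_of_nonneg_right h7 (sq_nonneg D)
  nlinarith [sq_pos_of_pos hD]

theorem Admissible.exists_terminatesAt (hL : IsLoss S L)
    (hA : Admissible S L β γ₁ γ₂ αmax α₁) {tmax : EReal} (htmax : 0 < tmax)
    (hfinite : ∃ x, IsPathPoint S L tmax x) :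
    ∃ N, TerminatesAt L α₁ tmax (run L β γ₁ γ₂ αmax α₁) N := by
  classical
  by_cases h : ∃ N, 1 ≤ N ∧ Stops L α₁ tmax (run L β γ₁ γ₂ αmax α₁ N)
  · exact ⟨Nat.find h, (Nat.find_spec h).1, (Nat.find_spec h).2,
      fun k h1 h2 h3 => Nat.find_min h h2 ⟨h1, h3⟩⟩
  exfalso
  push Not at h
  have hinv : ∀ k, Invariant S L β γ₁ γ₂ α₁ (run L β γ₁ γ₂ αmax α₁ (k + 1)) :=
    fun k => hA.invariant hL k fun j h1 _ => h j h1
  induction tmax with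
  | bot => exact absurd htmax (by simp)
  | coe T =>
    obtain ⟨k, hk⟩ := hA.not_bounded hL h T
    exact h (k + 1) (by omega) (Or.inl (EReal.coe_lt_coe_iff.2 hk))
  | top =>
    obtain ⟨y, ⟨hy, hmin⟩, -⟩ := hfinite
    simp only [objective_top] at hmin
    obtain ⟨k, hk⟩ := hA.not_bounded hL h
      (2 * Real.log (2 + 100 * ‖y‖ / ((Real.exp α₁ - 1) * ‖gradient L 0‖)))
    refine absurd hk (not_lt.2 ?_)
    refine bounded_of_minimizer hL hy hmin hA.tolerance_pos
      (hA.first_pos.trans_le (hinv k).le_time) (hinv k).nearPath ?_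
    have := h (k + 1) (by omega)
    rw [Stops, not_or, not_le] at this
    rw [mul_pow]
    exact this.2

end Run

/-! ### The path after termination -/

/-- Comes from differentiability of the gradient at `0` alone, so `r` and `K` depend on `L` and not
on `β`, `γ₁`, `γ₂`. -/
theorem IsLoss.exists_gradient_lipschitz_at_zero (hL : IsLoss S L) :
    ∃ r > 0, ∃ K > 0, ∀ x, ‖x‖ < r → ‖gradient L x - gradient L 0‖ ≤ K * ‖x‖ := by
  have h := (hL.differentiable_gradient 0 hL.zero_mem).hasFDerivAt.isBigO_sub
  obtain ⟨K, hK, hb⟩ := h.exists_pos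
  obtain ⟨r, hr, hball⟩ := Metric.eventually_nhds_iff.1 hb.bound
  refine ⟨r, hr, K, hK, fun x hx => ?_⟩
  simpa using hball (y := x) (by simpa using hx)

theorem exp_half_mul_le {a t : ℝ} (ha0 : 0 < a) (ha1 : a ≤ 1) (hat : a ≤ Real.exp t - 1) :
    Real.exp (t / 2) * a ≤ 3 / 2 * (Real.exp t - 1) := by
  have hE : Real.exp t = Real.exp (t / 2) ^ 2 := by
    rw [← Real.exp_nat_mul]
    congr 1
    norm_num
    ring
  have hs : 0 < Real.exp t - 1 := ha0.trans_le hat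
  refine le_of_sq_le_sq ?_ (by linarith)
  rw [mul_pow, ← hE]
  set s := Real.exp t - 1 with hs'
  have : Real.exp t = s + 1 := by rw [hs']; ring
  rw [this]
  have h1 : a ^ 2 ≤ s ^ 2 := by gcongr
  have h2 : a ^ 2 ≤ s := by nlinarith
  nlinarith

/-- When the method stops by its second criterion, the iterate is not small. -/
theorem norm_ge_of_stops {β γ₁ γ₂ a t r K : ℝ} {x : Vec p} (hG : gradient L 0 ≠ 0) (hK : 0 < K)
    (hlip : ∀ x, ‖x‖ < r → ‖gradient L x - gradient L 0‖ ≤ K * ‖x‖)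
    (ha0 : 0 < a) (ha1 : a ≤ 1 / 5) (hat : a ≤ Real.exp t - 1)
    (hn : NearPath S L β γ₁ γ₂ (a * ‖gradient L 0‖) t x)
    (hx : 2 * ‖x‖ ^ 2 ≤ (a * ‖gradient L 0‖) ^ 2 * (Real.exp t - 1)) :
    min r (2 / 5 * ‖gradient L 0‖ / K) ≤ ‖x‖ := by
  have hG0 : 0 < ‖gradient L 0‖ := norm_pos_iff.2 hG
  by_cases hr : ‖x‖ < r
  swap
  · exact (min_le_left _ _).trans (not_lt.1 hr)
  refine (min_le_right _ _).trans ?_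
  have hs : 0 < Real.exp t - 1 := ha0.trans_le hat
  have h1 := hn.resid_le
  have h2 := mul_le_mul_of_nonneg_right (exp_half_mul_le ha0 (by linarith) hat) hG0.le
  have h3 := hlip x hr
  set s := Real.exp t - 1
  -- Near `0` the gradient is close to `∇L(0) ≠ 0`, and the residual is at most `s‖∇L(0)‖/20`; only
  -- `x` itself can balance `s ∇L(0)`.
  have h4 : s * ‖gradient L 0‖ ≤ ‖resid L s x‖ + ‖x‖ + s * ‖gradient L x - gradient L 0‖ := by
    have e : s • gradient L 0 = resid L s x - x - s • (gradient L x - gradient L 0) := by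
      rw [resid, smul_sub]; abel
    have h5 := norm_sub_le (resid L s x - x) (s • (gradient L x - gradient L 0))
    have h6 := norm_sub_le (resid L s x) x
    rw [← e, norm_smul, norm_smul, Real.norm_of_nonneg hs.le] at h5
    linarith
  have h5 := mul_le_mul_of_nonneg_left h3 hs.le
  have hsG : 0 < s * ‖gradient L 0‖ := mul_pos hs hG0
  have h6 : 19 / 20 * (s * ‖gradient L 0‖) ≤ ‖x‖ * (1 + s * K) := by linarith
  -- Otherwise `‖x‖ ≥ (19/40) s‖∇L(0)‖`, too large for the stopping criterion because `a² ≤ s/5`.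
  have h7 : 1 < s * K := by
    by_contra! h
    have h8 : ‖x‖ * (1 + s * K) ≤ ‖x‖ * 2 :=
      mul_le_mul_of_nonneg_left (by linarith) (norm_nonneg _)
    have h9 : 19 / 40 * (s * ‖gradient L 0‖) ≤ ‖x‖ := by linarith
    have h10 : (19 / 40 * (s * ‖gradient L 0‖)) ^ 2 ≤ ‖x‖ ^ 2 := by gcongr
    have h11 : a ^ 2 ≤ 1 / 5 * s := by nlinarith
    have h12 : (a * ‖gradient L 0‖) ^ 2 * s ≤ 1 / 5 * s * ‖gradient L 0‖ ^ 2 * s := by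
      rw [mul_pow]; gcongr
    have h13 : 0 < (s * ‖gradient L 0‖) ^ 2 := by positivity
    nlinarith
  have h8 : ‖x‖ * (1 + s * K) ≤ ‖x‖ * (2 * (s * K)) :=
    mul_le_mul_of_nonneg_left (by linarith) (norm_nonneg _)
  rw [div_le_iff₀ hK]
  refine le_of_mul_le_mul_left ?_ hs
  nlinarith

/-- The gap of the loss at the final iterate. -/
theorem IsLoss.sub_le_of_stops (hL : IsLoss S L) {β γ₁ γ₂ D t c R G : ℝ} {x y : Vec p}
    (hD : 0 < D) (hDG : D ≤ G) (hc : 0 < c) (ht : 0 < t) (hn : NearPath S L β γ₁ γ₂ D t x)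
    (hx : 2 * ‖x‖ ^ 2 ≤ D ^ 2 * (Real.exp t - 1)) (hcx : c ≤ ‖x‖) (hy : y ∈ S)
    (hyR : ‖y‖ ≤ R) :
    L x - L y ≤ ((1 + G / c) + (2 + G / c) / c * R) * D ^ 2 := by
  have hs : 0 < Real.exp t - 1 := sub_pos.2 (Real.one_lt_exp_iff.2 ht)
  have hE : Real.exp t = Real.exp (t / 2) ^ 2 := by
    rw [← Real.exp_nat_mul]
    congr 1
    norm_num
    ring
  have h1 := hn.resid_le
  have h2 := hL.add_inner_le hn.mem hy
  set s := Real.exp t - 1 with hs'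
  have hz0 : 0 < √s := Real.sqrt_pos.2 hs
  have hz2 : √s ^ 2 = s := Real.sq_sqrt hs.le
  set z := √s
  have hE1 : Real.exp (t / 2) ≤ 1 + z := by
    refine le_of_sq_le_sq ?_ (by linarith)
    rw [← hE]
    nlinarith
  have hxz : ‖x‖ ≤ D * z := by
    refine le_of_sq_le_sq ?_ (by positivity)
    rw [mul_pow, hz2]
    nlinarith [norm_nonneg x]
  have hrz : ‖resid L s x‖ ≤ (1 + z) * D := by
    have h3 : Real.exp (t / 2) * D ≤ (1 + z) * D := by gcongr
    have h4 : 0 ≤ (1 + z) * D := by positivity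
    linarith
  -- From `c ≤ ‖x‖ ≤ D z`: stopping happens only when `√s` is of order at least `1/D`. This supplies
  -- the second factor `D` in the term with `R`.
  have hzc : z⁻¹ ≤ D / c := by
    rw [inv_le_comm₀ hz0 (by positivity), inv_div, div_le_iff₀ hD]
    linarith
  have hzG : z⁻¹ ≤ G / c := hzc.trans (by gcongr)
  have hR : 0 ≤ R := (norm_nonneg y).trans hyR
  have h5 : s * (L x - L y) ≤ ((1 + z) * D) * (D * z) + ((1 + z) * D + D * z) * R := by
    have e : s * ⟪gradient L x, y - x⟫ =
        ⟪resid L s x, y⟫ - ⟪resid L s x, x⟫ - ⟪x, y⟫ + ‖x‖ ^ 2 := by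
      rw [resid, inner_add_left, inner_add_left, real_inner_smul_left, real_inner_smul_left,
        real_inner_self_eq_norm_sq, inner_sub_right]
      ring
    have h6 := mul_le_mul_of_nonneg_left h2 hs.le
    rw [mul_add, e] at h6
    have h7 := neg_le_of_abs_le (abs_real_inner_le_norm (resid L s x) y)
    have h8 := real_inner_le_norm (resid L s x) x
    have h9 := real_inner_le_norm x y
    have h10 : ‖resid L s x‖ * ‖x‖ ≤ ((1 + z) * D) * (D * z) := by gcongr
    have h11 : ‖resid L s x‖ * ‖y‖ ≤ (1 + z) * D * R := by gcongr
    have h12 : ‖x‖ * ‖y‖ ≤ D * z * R := by gcongr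
    nlinarith [sq_nonneg ‖x‖]
  have h6 : L x - L y ≤ (1 + z⁻¹) * D ^ 2 + (2 + z⁻¹) * z⁻¹ * D * R := by
    refine le_of_mul_le_mul_left (h5.trans_eq ?_) hs
    rw [← hz2]
    field_simp
    ring
  refine h6.trans ?_
  have hGc : 0 < G / c := div_pos (hD.trans_le hDG) hc
  calc (1 + z⁻¹) * D ^ 2 + (2 + z⁻¹) * z⁻¹ * D * R
      ≤ (1 + G / c) * D ^ 2 + (2 + G / c) * (D / c) * D * R := by gcongr
    _ = _ := by ring

theorem expNeg_nonneg (t : EReal) : 0 ≤ expNeg t := ENNReal.toReal_nonneg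

theorem expNeg_le {t : ℝ} {τ : EReal} (h : (t : EReal) ≤ τ) : expNeg τ ≤ Real.exp (-t) := by
  induction τ with
  | bot => simp at h
  | coe τ =>
    rw [expNeg_coe]
    exact Real.exp_le_exp.2 (neg_le_neg (EReal.coe_le_coe_iff.1 h))
  | top => rw [expNeg_top]; exact (Real.exp_pos _).le

/-- The suboptimality of the final iterate at all later times. -/
theorem objective_sub_le_of_later {D t C : ℝ} {x y : Vec p} {τ : EReal} (ht : 0 < t)
    (hτ : (t : EReal) ≤ τ) (hx : 2 * ‖x‖ ^ 2 ≤ D ^ 2 * (Real.exp t - 1)) (hC : 0 ≤ C)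
    (h : L x - L y ≤ C * D ^ 2) : objective L τ x - objective L τ y ≤ (C + 1) * D ^ 2 := by
  have h0 := expNeg_nonneg τ
  have h1 := expNeg_le hτ
  have h2 : Real.exp (-t) ≤ 1 := Real.exp_le_one_iff.2 (by linarith)
  have hs : 0 < Real.exp t - 1 := sub_pos.2 (Real.one_lt_exp_iff.2 ht)
  have h3 : expNeg τ * (Real.exp t - 1) ≤ 1 := by
    refine (mul_le_mul_of_nonneg_right h1 hs.le).trans ?_
    rw [← one_sub_exp_neg]
    linarith [Real.exp_pos (-t)]
  rw [objective, objective]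
  set c := expNeg τ
  have h4 : (1 - c) * (L x - L y) ≤ C * D ^ 2 := by
    refine (mul_le_mul_of_nonneg_left h (by linarith)).trans ?_
    have : 0 ≤ C * D ^ 2 := by positivity
    nlinarith
  have h5 := mul_le_mul_of_nonneg_left hx h0
  have h6 := mul_le_mul_of_nonneg_right h3 (sq_nonneg D)
  have h7 : 0 ≤ c * ‖y‖ ^ 2 := by positivity
  have h8 : 0 ≤ c * ‖x‖ ^ 2 := by positivity
  nlinarith

/-- For `tmax = ∞` any minimizer of `L` bounds the path: it beats `θ(t)` in `L`, so `θ(t)` must do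
at least as well in norm. -/
theorem IsLoss.solutionPath_bounded (hL : IsLoss S L) {tmax : EReal}
    (hfinite : ∃ x, IsPathPoint S L tmax x) :
    ∃ R, ∀ t : EReal, 0 ≤ t → t ≤ tmax → solutionPath S L t ∈ S ∧ ‖solutionPath S L t‖ ≤ R := by
  induction tmax with
  | bot => exact ⟨0, fun t h0 h1 => absurd (h0.trans h1) (by simp)⟩
  | coe T =>
    refine ⟨2 * (Real.exp T - 1) * ‖gradient L 0‖, fun t h0 h1 => ?_⟩
    lift t to ℝ using ⟨ne_of_lt (h1.trans_lt (EReal.coe_lt_top T)),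
      ne_of_gt ((EReal.bot_lt_coe 0).trans_le h0)⟩
    have h0' : 0 ≤ t := EReal.coe_nonneg.1 h0
    have h := hL.isMinimizer_solutionPath h0'
    refine ⟨h.1, (hL.norm_le_of_objective_le h.1 h0' (h.2 0 hL.zero_mem)).trans ?_⟩
    have := Real.exp_le_exp.2 (EReal.coe_le_coe_iff.1 h1)
    gcongr
  | top =>
    obtain ⟨y, hy⟩ := hfinite
    refine ⟨‖y‖, fun t h0 _ => ?_⟩
    induction t with
    | bot => simp at h0
    | coe t =>
      have h0' : 0 ≤ t := EReal.coe_nonneg.1 h0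
      have h := hL.isMinimizer_solutionPath h0'
      refine ⟨h.1, ?_⟩
      have h1 := h.2 y hy.1.1
      have h2 := hy.1.2 _ h.1
      rw [objective_coe, objective_coe] at h1
      rw [objective_top, objective_top] at h2
      have ha : 0 ≤ 1 - Real.exp (-t) := sub_nonneg.2 (Real.exp_le_one_iff.2 (by linarith))
      have h3 := mul_le_mul_of_nonneg_left h2 ha
      refine le_of_sq_le_sq ?_ (norm_nonneg _)
      refine le_of_mul_le_mul_left ?_ (Real.exp_pos (-t))
      linarith
    | top =>
      have h : IsPathPoint S L ⊤ (solutionPath S L ⊤) := Classical.epsilon_spec ⟨y, hy⟩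
      exact ⟨h.1.1, h.2 y hy.1⟩

/-! ### The generated path -/

/-- The index chosen by `Nat.findGreatest` brackets `t` without any monotonicity of the grid; `t =
∞` falls in the first case because grid times are finite. -/
theorem interpolation_cases (s : ℕ → State p) (N : ℕ) {t : EReal} (h0 : ((s 0).time : EReal) ≤ t) :
    (((s N).time : EReal) ≤ t ∧ interpolation s N t = (s N).iterate) ∨
      ∃ k < N, ∃ τ : ℝ, t = τ ∧ (s k).time ≤ τ ∧ τ < (s (k + 1)).time ∧
        interpolation s N t =
          (((s (k + 1)).time - τ) / ((s (k + 1)).time - (s k).time)) • (s k).iterate +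
            ((τ - (s k).time) / ((s (k + 1)).time - (s k).time)) • (s (k + 1)).iterate := by
  classical
  set k := Nat.findGreatest (fun j => ((s j).time : EReal) ≤ t) N with hk
  have hle : k ≤ N := Nat.findGreatest_le N
  have hkt : ((s k).time : EReal) ≤ t :=
    Nat.findGreatest_spec (P := fun j => ((s j).time : EReal) ≤ t) (Nat.zero_le N) h0
  by_cases h : k = N
  · left
    refine ⟨h ▸ hkt, ?_⟩
    unfold interpolation
    convert if_pos h
  · right
    have hlt : k < N := lt_of_le_of_ne hle h
    have hnot : t < ((s (k + 1)).time : EReal) := not_le.1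
      (Nat.findGreatest_is_greatest (P := fun j => ((s j).time : EReal) ≤ t) (Nat.lt_succ_self k)
        hlt)
    lift t to ℝ using ⟨ne_of_lt (hnot.trans (EReal.coe_lt_top _)),
      ne_of_gt ((EReal.bot_lt_coe _).trans_le hkt)⟩
    refine ⟨k, hlt, t, rfl, EReal.coe_le_coe_iff.1 hkt, EReal.coe_lt_coe_iff.1 hnot, ?_⟩
    unfold interpolation
    convert if_neg h <;> exact (EReal.toReal_coe t).symm

/-- Before termination, the generated path is suboptimal by at most three times the squared
tolerance. -/
theorem Admissible.segment_error {β γ₁ γ₂ αmax α₁ : ℝ} (hL : IsLoss S L)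
    (hA : Admissible S L β γ₁ γ₂ αmax α₁) {tmax : EReal} {k : ℕ}
    (hk : ∀ j, 1 ≤ j → j < k + 1 → ¬ Stops L α₁ tmax (run L β γ₁ γ₂ αmax α₁ j)) {τ : ℝ}
    (h1 : (run L β γ₁ γ₂ αmax α₁ k).time ≤ τ) (h2 : τ < (run L β γ₁ γ₂ αmax α₁ (k + 1)).time)
    {y : Vec p} (hy : y ∈ S) {u v : ℝ} (hu : 0 ≤ u) (hv : 0 ≤ v) (huv : u + v = 1) :
    u • (run L β γ₁ γ₂ αmax α₁ k).iterate + v • (run L β γ₁ γ₂ αmax α₁ (k + 1)).iterate ∈ S ∧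
      objective L τ (u • (run L β γ₁ γ₂ αmax α₁ k).iterate +
        v • (run L β γ₁ γ₂ αmax α₁ (k + 1)).iterate) - objective L τ y ≤
        3 * ((Real.exp α₁ - 1) * ‖gradient L 0‖) ^ 2 := by
  rcases k with _ | k
  · have ht : (run L β γ₁ γ₂ αmax α₁ 1).time = α₁ := zero_add _
    have hx : (run L β γ₁ γ₂ αmax α₁ 1).iterate = newtonStep L α₁ 0 := by
      rw [run_succ_iterate]
      change newtonStep L (0 + α₁) 0 = _
      rw [zero_add]
    obtain ⟨hn, hd⟩ := hA.first_step hL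
    rw [zero_add, ht] at h2
    rw [zero_add, hx]
    exact hL.first_segment_error hA.first_pos rfl hn hd hA.first_le h1 h2.le hy hu hv huv
  · have hi := hA.invariant hL k fun j h1 h2 => hk j h1 (by omega)
    have hg := hi.goodStep (iterate_ne_zero_of_not_stops (hk (k + 1) (by omega) (by omega)))
    exact hL.segment_error hA.lipschitz hA.tolerance_pos.le (hA.first_pos.trans_le hi.le_time)
      hi.nearPath hg h1 h2.le hy hu hv huv

end NewtonPath

/-! ### The main theorem. -/

theorem mainTheorem6 {p : ℕ} (S : Set (NewtonPath.Vec p)) (L : NewtonPath.Vec p → ℝ)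
    (hL : NewtonPath.IsLoss S L) (hgrad : gradient L 0 ≠ 0)
    (tmax : EReal) (htmax : 0 < tmax)
    (hfinite : ∃ x, NewtonPath.IsPathPoint S L tmax x) :
    ∃ C : ℝ, 0 < C ∧
      ∀ β γ₁ γ₂ : ℝ, NewtonPath.LocalLipschitzHessian S L β γ₁ γ₂ →
      ∀ ε αmax α₁ : ℝ, 0 < ε → 0 < αmax → αmax ≤ 1 / 10 →
        0 < α₁ → α₁ ≤ NewtonPath.firstStepBound L β γ₁ γ₂ ε αmax α₁ →
        ∃ N : ℕ,
          NewtonPath.TerminatesAt L α₁ tmax (NewtonPath.run L β γ₁ γ₂ αmax α₁) N ∧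
          (∀ k ≤ N, (NewtonPath.run L β γ₁ γ₂ αmax α₁ k).iterate ∈ S) ∧
          ∀ t : EReal, 0 ≤ t → t ≤ tmax →
            NewtonPath.interpolation (NewtonPath.run L β γ₁ γ₂ αmax α₁) N t ∈ S ∧
            NewtonPath.objective L t
                (NewtonPath.interpolation (NewtonPath.run L β γ₁ γ₂ αmax α₁) N t) -
              NewtonPath.objective L t (NewtonPath.solutionPath S L t) ≤ C * ε := by
  obtain ⟨R, hR⟩ := hL.solutionPath_bounded hfinite
  obtain ⟨r, hr, K, hK, hlip⟩ := hL.exists_gradient_lipschitz_at_zero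
  have hG0 : 0 < ‖gradient L 0‖ := norm_pos_iff.2 hgrad
  have hR0 : 0 ≤ R := (norm_nonneg _).trans (hR 0 le_rfl htmax.le).2
  set G := ‖gradient L 0‖ with hG
  set c := min r (2 / 5 * G / K) with hc
  have hc0 : 0 < c := lt_min hr (by positivity)
  set C₀ := (1 + G / c) + (2 + G / c) / c * R with hC₀
  have hC₀0 : 0 ≤ C₀ := by positivity
  -- `3` pays for the segments, `C₀ + 1` for the times after termination.
  refine ⟨C₀ + 3, by linarith, ?_⟩
  intro β γ₁ γ₂ hH ε αmax α₁ hε hmax hmax' hα₁ hbound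
  obtain ⟨hα1, hDε, hb1, hb2⟩ :=
    NewtonPath.firstStepBound_spec hH hgrad hε hmax' hα₁ hbound
  have hA : NewtonPath.Admissible S L β γ₁ γ₂ αmax α₁ :=
    ⟨hH, hgrad, hmax, hmax', hα₁, hα1, hb1, hb2⟩
  obtain ⟨N, hN⟩ := hA.exists_terminatesAt hL htmax hfinite
  have hinv : ∀ k, k < N →
      NewtonPath.Invariant S L β γ₁ γ₂ α₁ (NewtonPath.run L β γ₁ γ₂ αmax α₁ (k + 1)) :=
    fun k hk => hA.invariant hL k fun j h1 h2 => hN.2.2 j h1 (by omega)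
  refine ⟨N, hN, fun k hk => ?_, fun t h0 ht => ?_⟩
  · rcases k with _ | k
    · exact hL.zero_mem
    · exact (hinv k hk).nearPath.mem
  obtain ⟨hyS, hyR⟩ := hR t h0 ht
  rcases NewtonPath.interpolation_cases (NewtonPath.run L β γ₁ γ₂ αmax α₁) N h0 with
    ⟨hNt, heq⟩ | ⟨k, hk, τ, rfl, h1, h2, heq⟩
  · obtain ⟨n, rfl⟩ : ∃ n, N = n + 1 := ⟨N - 1, by have := hN.1; omega⟩
    have hi := hinv n (Nat.lt_succ_self n)
    have htpos := hα₁.trans_le hi.le_time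
    have hs : 0 < Real.exp (NewtonPath.run L β γ₁ γ₂ αmax α₁ (n + 1)).time - 1 :=
      sub_pos.2 (Real.one_lt_exp_iff.2 htpos)
    -- Here `t_N ≤ t ≤ tmax`, so the stop was due to the second criterion.
    have hcrit := hN.2.1.resolve_left (not_lt.2 (hNt.trans ht))
    rw [div_le_iff₀ hs, ← mul_pow] at hcrit
    rw [heq]
    refine ⟨hi.nearPath.mem, ?_⟩
    have ha1 : Real.exp α₁ - 1 ≤ 1 / 5 := by
      have h3 := Real.exp_bound_div_one_sub_of_interval hα₁.le (by linarith : α₁ < 1)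
      have h4 : 1 / (1 - α₁) ≤ 6 / 5 := by
        rw [div_le_iff₀ (by linarith)]
        linarith
      linarith
    have ha0 : 0 < Real.exp α₁ - 1 := sub_pos.2 (Real.one_lt_exp_iff.2 hα₁)
    have hcx := NewtonPath.norm_ge_of_stops hgrad hK hlip ha0 ha1
      (sub_le_sub_right (Real.exp_le_exp.2 hi.le_time) _) hi.nearPath hcrit
    have hgap := hL.sub_le_of_stops hA.tolerance_pos
      (mul_le_of_le_one_left hG0.le (by linarith)) hc0 htpos hi.nearPath hcrit hcx hyS hyR
    refine (NewtonPath.objective_sub_le_of_later htpos hNt hcrit hC₀0 hgap).trans ?_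
    have := mul_le_mul_of_nonneg_left hDε (by linarith : 0 ≤ C₀ + 1)
    linarith
  · have hlt := h1.trans_lt h2
    rw [heq]
    obtain ⟨hm, he⟩ := hA.segment_error hL (fun j h3 h4 => hN.2.2 j h3 (by omega)) h1 h2 hyS
      (div_nonneg (sub_nonneg.2 h2.le) (sub_nonneg.2 hlt.le))
      (div_nonneg (sub_nonneg.2 h1) (sub_nonneg.2 hlt.le))
      (by
        rw [← add_div, sub_add_sub_cancel]
        exact div_self (sub_ne_zero.2 hlt.ne'))
    refine ⟨hm, he.trans ?_⟩
    have := mul_nonneg hC₀0 hε.le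
    linarith
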